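/- Let $R$ be a commutative ring and let $W=\{W_n:\mathbb Z\to R\}_{n\ge 0}$ be an admissible family: $W_2(0)=1$, $W_2(r)=0$ for $r\ne 0$, and $W_n(r+1)-W_n(r-1)=W_{n-1}(r)$ for all $n\ge 1$, $r\in\mathbb Z$. Let $\Gamma$ be the star-shaped plumbing graph of the Seifert manifold $M=M(b;(a_1,b_1),(a_2,b_2),(a_3,b_3))$, where $a_i>0$ and $\gcd(a_i,b_i)=1$: it has one node of weight $-b$ and three legs, the $i$-th leg having, from the node outwards, weights $-c^i_1,\dots,-c^i_{\ell_i}$ ($\ell_i\ge 1$, $c^i_j\in\mathbb Z$) with $$\frac{a_i}{b_i}=c^i_1-\cfrac{1}{c^i_2-\cfrac{1}{\ddots-\cfrac{1}{c^i_{\ell_i}}}} .$$ Assume that the plumbing matrix of $\Gamma$, also denoted $M$ (weights on the diagonal, adjacency off the diagonal), is negative definite. Let $s$ be the number of vertices, $m\in\mathbb Z^s$ the vector of weights, $\delta$ the vector of degrees, $u=(1,\dots,1)$, $\langle x,y\rangle=x^tMy$, and $|H|=|H_1(M;\mathbb Z)|=|\mathbb Z^s/M\mathbb Z^s|$. For $[k]\in(m+2\mathbb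 Z^s)/2M\mathbb Z^s$ (the spin$^c$ structures) put $$P^\infty_{W,[k]}(M)(t,q)=\sum_{x\in\mathbb Z^s}\Big(\prod_{v}W_{\delta_v}\big((2Mx+k-Mu)_v\big)\Big)\,q^{\varepsilon_k(x)}\,t^{\Theta_k+\langle x,u\rangle},$$ $$\Theta_k=\frac{k\cdot u-\langle u,u\rangle}{2},\qquad \varepsilon_k(x)=-\frac{(k-Mu)^tM^{-1}(k-Mu)+3s+\sum_v m_v}{4}-\big(k\cdot x+\langle x,x\rangle\big)+\langle x,u\rangle ,$$ and $P^\infty_{W,0}(M)=\sum_{[k]}P^\infty_{W,[k]}(M)$. Let $A=a_1a_2a_3$, $\overline{a_i}=A/a_i$ and $$f_0(t,z)=\frac{\prod_{i=1}^3\big(z^{\overline{a_i}}t^{-1}-z^{-\overline{a_i}}t\big)}{z^{A}t^{-1}-z^{-A}t}.$$ For $y\in R$ let $\mathrm{a.e.}_y(f_0)$ be $(1-y)$ times the Laurent expansion of $f_0$ in $z$ at $z=0$ plus $y$ times its Laurent expansion at $z=\infty$ (coefficients in $R[t,t^{-1}]$), and let $\mathcal L_A$ be the Laplace transform $z^nt^j\mapsto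 q^{n^2/4A}t^j$. Finally let $$\Delta=-\frac{|H|\,(3s+\sum_v m_v)}{4}+\frac14\sum_{i=1}^3\Big(-|H|\,(M^{-1})_{v_iv_i}-\frac{A}{a_i^2}\Big),$$ where $v_i$ is the leaf at the end of the $i$-th leg. Then, as formal series, $$P^\infty_{W,0}(M)(t^2,q^{|H|})=q^{\Delta}\,\mathcal L_A\big(\mathrm{a.e.}_{W_3(1)}(f_0(t,z))\big).$$ Moreover, suppose that $2$ is invertible in $R$, and let $\widehat W$ be the family in which $\widehat W_d(n)$ is the coefficient of $z^{-n}$ in the symmetric expansion $\mathrm{s.e.}=\mathrm{a.e.}_{1/2}$ of $(z-z^{-1})^{2-d}$, with $\widehat{\widehat Z}_0(M):=P^\infty_{\widehat W,0}(M)$. If $W_3(1)=\tfrac12$, then $P^\infty_{W,0}(M)=\widehat{\widehat Z}_0(M)$, and $\widehat{\widehat Z}_0(M)(t^2,q^{|H|})=q^\Delta\mathcal L_A(\mathrm{s.e.}(f_0(t,z)))$. -/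

import Mathlib

open LaurentPolynomial

/-! ## Formal series -/

/-- Two-variable formal series in `q` (rational exponents) and `t` (integer exponents): the value at
`e` is the coefficient of `q ^ e`, a Laurent polynomial in `t` (written `T` in Mathlib). -/
abbrev TQSeries (R : Type*) [CommRing R] : Type _ := ℚ → R[T;T⁻¹]

/-- The substitution `t ↦ t ^ 2` in a Laurent polynomial. -/
noncomputable def tSquare {R : Type*} [CommRing R] : R[T;T⁻¹] →+* R[T;T⁻¹] :=
  AddMonoidAlgebra.mapDomainRingHom R (AddMonoidHom.mulLeft (2 : ℤ))

/-- The series `F (t ^ 2, q ^ h)`, for `h > 0`: the coefficient of `q ^ e` in it is the coefficient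
of `q ^ (e / h)` in `F`, with `t` replaced by `t ^ 2`. -/
noncomputable def TQSeries.subst {R : Type*} [CommRing R] (F : TQSeries R) (h : ℕ) : TQSeries R :=
  fun e => tSquare (F (e / h))

/-- The series `q ^ d * F`. -/
def TQSeries.qShift {R : Type*} [CommRing R] (d : ℚ) (F : TQSeries R) : TQSeries R :=
  fun e => F (e - d)

/-! ## Laurent expansions of rational functions -/

/-- The variable `X`, as a unit of the ring of formal Laurent series. -/
noncomputable def laurentX (S : Type*) [CommRing S] : (LaurentSeries S)ˣ where
  val := HahnSeries.single 1 1
  inv := HahnSeries.single (-1) 1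
  val_inv := by simp
  inv_val := by simp

/-- Laurent polynomials inside formal Laurent series. -/
noncomputable def toLaurentSeries {S : Type*} [CommRing S] : S[T;T⁻¹] →+* LaurentSeries S :=
  LaurentPolynomial.eval₂ HahnSeries.C (laurentX S)

/-- Coefficient of `z ^ n` in the Laurent expansion at `z = 0` of the rational function `N / D`
(where `D` is invertible as a formal Laurent series in `z`). -/
noncomputable def expansionZero {S : Type*} [CommRing S] (N D : S[T;T⁻¹]) (n : ℤ) : S :=
  (toLaurentSeries N * Ring.inverse (toLaurentSeries D)).coeff n

/-- Coefficient of `z ^ n` in the Laurent expansion at `z = ∞` of the rational function `N / D`: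
expand `N / D` in powers of `w = z⁻¹`. -/
noncomputable def expansionInfty {S : Type*} [CommRing S] (N D : S[T;T⁻¹]) (n : ℤ) : S :=
  expansionZero (LaurentPolynomial.invert N) (LaurentPolynomial.invert D) (-n)

/-- The asymmetric expansion
`(1 - y) * (expansion at 0) + y * (expansion at ∞)` of the rational function `N / D`; the value at
`n` is the coefficient of `z ^ n`. -/
noncomputable def asymExpansion {R S : Type*} [CommRing R] [CommRing S] [Algebra R S]
    (y : R) (N D : S[T;T⁻¹]) (n : ℤ) : S :=
  (1 - y) • expansionZero N D n + y • expansionInfty N D n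

/-- The symmetric expansion: the average of the expansions at `0` and `∞` (`R` is a ring of scalars
containing `1 / 2`). -/
noncomputable def symExpansion (R : Type*) {S : Type*} [CommRing R] [CommRing S] [Algebra R S]
    [Invertible (2 : R)] (N D : S[T;T⁻¹]) (n : ℤ) : S :=
  ⅟(2 : R) • expansionZero N D n + ⅟(2 : R) • expansionInfty N D n

/-- The Laplace transform `z ^ n * t ^ m ↦ q ^ (n ^ 2 / (4 * A)) * t ^ m`, applied to the bilateral
series with coefficient `g n` (a Laurent polynomial in `t`) at `z ^ n`. For `A ≠ 0` at most two `n`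
contribute to a given exponent of `q`. -/
noncomputable def laplace {R : Type*} [CommRing R] (A : ℤ) (g : ℤ → R[T;T⁻¹]) : TQSeries R :=
  fun e => ∑ᶠ (n : ℤ) (_ : (n : ℚ) ^ 2 / (4 * A) = e), g n

/-! ## Admissible families -/

/-- Admissible families of functions `W n : ℤ → R`. -/
structure IsAdmissible {R : Type*} [CommRing R] (W : ℕ → ℤ → R) : Prop where
  two_zero : W 2 0 = 1
  two_ne_zero : ∀ r : ℤ, r ≠ 0 → W 2 r = 0
  step : ∀ n : ℕ, 1 ≤ n → ∀ r : ℤ, W n (r + 1) - W n (r - 1) = W (n - 1) r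

/-- The family `Ŵ`: `Ŵ d n` is the coefficient of `z ^ (-n)` in the symmetric expansion of
`(z - z⁻¹) ^ (2 - d)`. The exponents below are truncated, so that one of the two powers is `1` and
the quotient is `(z - z⁻¹) ^ (2 - d)` for every `d`. -/
noncomputable def WHat (R : Type*) [CommRing R] [Invertible (2 : R)] (d : ℕ) (n : ℤ) : R :=
  symExpansion R ((T 1 - T (-1) : R[T;T⁻¹]) ^ (2 - d)) ((T 1 - T (-1) : R[T;T⁻¹]) ^ (d - 2)) (-n)

/-! ## Plumbing graphs -/

/-- A graph with integer weights on its vertices. -/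
structure PlumbingGraph (V : Type*) where
  graph : SimpleGraph V
  weight : V → ℤ

namespace PlumbingGraph

open Classical in
/-- The plumbing matrix: weights on the diagonal, adjacency off the diagonal. -/
noncomputable def matrix {V : Type*} (Γ : PlumbingGraph V) : Matrix V V ℤ :=
  Matrix.of fun v w => if v = w then Γ.weight v else if Γ.graph.Adj v w then 1 else 0

open Classical in
/-- The degree `δ v` of a vertex. -/
noncomputable def deg {V : Type*} [Fintype V] (Γ : PlumbingGraph V) (v : V) : ℕ :=
  Γ.graph.degree v

/-- The plumbing matrix is negative definite. -/
def NegDef {V : Type*} (Γ : PlumbingGraph V) : Prop :=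
  (-(Γ.matrix.map (Int.cast : ℤ → ℝ))).PosDef

/-- The bilinear form `⟨x, y⟩` of the plumbing matrix. -/
noncomputable def form {V : Type*} [Fintype V] (Γ : PlumbingGraph V) (x y : V → ℤ) : ℤ :=
  x ⬝ᵥ Γ.matrix.mulVec y

/-- The inverse of the plumbing matrix, with rational entries. -/
noncomputable def invMatrix {V : Type*} [Fintype V] [DecidableEq V] (Γ : PlumbingGraph V) :
    Matrix V V ℚ :=
  (Γ.matrix.map (Int.cast : ℤ → ℚ))⁻¹

/-- The square `ℓ² = ℓᵗ M⁻¹ ℓ`. -/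
noncomputable def invSq {V : Type*} [Fintype V] [DecidableEq V] (Γ : PlumbingGraph V)
    (l : V → ℤ) : ℚ :=
  (fun v => (l v : ℚ)) ⬝ᵥ Γ.invMatrix.mulVec (fun v => (l v : ℚ))

/-- `k - M u`, where `u = (1, 1, …)`. -/
noncomputable def shift {V : Type*} [Fintype V] (Γ : PlumbingGraph V) (k : V → ℤ) : V → ℤ :=
  k - Γ.matrix.mulVec 1

/-- `χ_k(x) = -(k · x + ⟨x, x⟩) / 2`. -/
noncomputable def chi {V : Type*} [Fintype V] (Γ : PlumbingGraph V) (k x : V → ℤ) : ℚ :=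
  -((k ⬝ᵥ x + Γ.form x x : ℤ) : ℚ) / 2

/-- `Θ_k = (k · u - ⟨u, u⟩) / 2`; the division is exact when `k` is congruent to the weight
vector mod 2, see `two_dvd_theta`. -/
noncomputable def theta {V : Type*} [Fintype V] (Γ : PlumbingGraph V) (k : V → ℤ) : ℤ :=
  (k ⬝ᵥ 1 - Γ.form 1 1) / 2

/-- The exponent of `q`:
`ε_k(x) = -((k - M u)² + 3 s + ∑ v, m v) / 4 + 2 χ_k(x) + ⟨x, u⟩`. -/
noncomputable def qExp {V : Type*} [Fintype V] [DecidableEq V] (Γ : PlumbingGraph V)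
    (k x : V → ℤ) : ℚ :=
  -(Γ.invSq (Γ.shift k) + 3 * Fintype.card V + ∑ v, (Γ.weight v : ℚ)) / 4
    + 2 * Γ.chi k x + Γ.form x 1

/-- The coefficient `W_{Γ,k}(x) = ∏ v, W (δ v) ((2 M x + k - M u) v)`. -/
noncomputable def coeffW {V : Type*} [Fintype V] {R : Type*} [CommRing R]
    (Γ : PlumbingGraph V) (W : ℕ → ℤ → R) (k x : V → ℤ) : R :=
  ∏ v, W (Γ.deg v) (2 * Γ.matrix.mulVec x v + Γ.shift k v)

/-- The series `∑ x, W_{Γ,k}(x) q ^ ε_k(x) t ^ (Θ_k + ⟨x, u⟩)` over `x ∈ ℤ ^ s`. In the negative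
definite case each power of `q` occurs for finitely many `x` only, see `finite_qExp_le`. -/
noncomputable def seriesRep {V : Type*} [Fintype V] [DecidableEq V] {R : Type*} [CommRing R]
    (Γ : PlumbingGraph V) (W : ℕ → ℤ → R) (k : V → ℤ) : TQSeries R :=
  fun e => ∑ᶠ (x : V → ℤ) (_ : Γ.qExp k x = e),
    C (Γ.coeffW W k x) * T (Γ.theta k + Γ.form x 1)

/-- Characteristic vectors: elements of `m + 2 ℤ ^ s`. -/
abbrev CharVec {V : Type*} (Γ : PlumbingGraph V) : Type _ :=
  {k : V → ℤ // ∀ v, k v ≡ Γ.weight v [ZMOD 2]}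

/-- Congruence modulo `2 M ℤ ^ s`. -/
def charSetoid {V : Type*} [Fintype V] (Γ : PlumbingGraph V) : Setoid Γ.CharVec where
  r k k' := ∃ y : V → ℤ, k'.1 = k.1 + 2 • Γ.matrix.mulVec y
  iseqv :=
    { refl := fun k => ⟨0, by simp⟩
      symm := by
        rintro k k' ⟨y, h⟩
        exact ⟨-y, by rw [h, Matrix.mulVec_neg]; simp⟩
      trans := by
        rintro k k' k'' ⟨y, h⟩ ⟨y', h'⟩
        exact ⟨y + y', by rw [h', h, Matrix.mulVec_add, smul_add, add_assoc]⟩ }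

/-- The set `(m + 2 ℤ ^ s) / 2 M ℤ ^ s` of spin^c structures. -/
def SpinC {V : Type*} [Fintype V] (Γ : PlumbingGraph V) : Type _ := Quotient Γ.charSetoid

/-- The order of `H₁`, the cokernel of the plumbing matrix. -/
noncomputable def orderH1 {V : Type*} [Fintype V] (Γ : PlumbingGraph V) : ℕ :=
  Nat.card ((V → ℤ) ⧸ LinearMap.range Γ.matrix.mulVecLin)

/-! ### Well-definedness -/

theorem matrix_transpose {V : Type*} (Γ : PlumbingGraph V) : Γ.matrix.transpose = Γ.matrix := by
  ext v w
  by_cases h : v = w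
  · subst h; rfl
  · by_cases h' : Γ.graph.Adj v w
    · simp [matrix, h, Ne.symm h, h', h'.symm]
    · have h'' : ¬Γ.graph.Adj w v := fun hh => h' hh.symm
      simp [matrix, h, Ne.symm h, h', h'']

theorem form_comm {V : Type*} [Fintype V] (Γ : PlumbingGraph V) (x y : V → ℤ) :
    Γ.form x y = Γ.form y x := by
  unfold form
  rw [Matrix.dotProduct_mulVec, ← Matrix.mulVec_transpose, matrix_transpose, dotProduct_comm]

theorem form_add_left {V : Type*} [Fintype V] (Γ : PlumbingGraph V) (x y z : V → ℤ) :
    Γ.form (x + y) z = Γ.form x z + Γ.form y z := add_dotProduct _ _ _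

theorem form_add_right {V : Type*} [Fintype V] (Γ : PlumbingGraph V) (x y z : V → ℤ) :
    Γ.form x (y + z) = Γ.form x y + Γ.form x z := by
  unfold form
  rw [Matrix.mulVec_add, dotProduct_add]

theorem two_dvd_theta {V : Type*} [Fintype V] (Γ : PlumbingGraph V) (k : Γ.CharVec) :
    2 ∣ k.1 ⬝ᵥ 1 - Γ.form 1 1 := by
  classical
  have h1 : Γ.form 1 1 = ∑ v, Γ.weight v + ∑ v, (Γ.graph.degree v : ℤ) := by
    unfold form
    rw [← Finset.sum_add_distrib]
    simp only [dotProduct, Matrix.mulVec, matrix, Matrix.of_apply, Pi.one_apply, one_mul, mul_one]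
    refine Finset.sum_congr rfl fun v _ => ?_
    rw [← Finset.add_sum_erase _ _ (Finset.mem_univ v), if_pos rfl]
    congr 1
    rw [Finset.sum_congr rfl (g := fun w => if Γ.graph.Adj v w then (1 : ℤ) else 0)]
    · rw [Finset.sum_erase _ (by simp), Finset.sum_boole, ← SimpleGraph.neighborFinset_eq_filter]
      simp
    · intro w hw
      rw [if_neg (Finset.ne_of_mem_erase hw).symm]
  have h2 : ∑ v, (Γ.graph.degree v : ℤ) = 2 * (Γ.graph.edgeFinset.card : ℤ) := by
    exact_mod_cast Γ.graph.sum_degrees_eq_twice_card_edges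
  have h3 : (2 : ℤ) ∣ ∑ v, (k.1 v - Γ.weight v) :=
    Finset.dvd_sum fun v _ => (k.2 v).symm.dvd
  rw [Finset.sum_sub_distrib] at h3
  have h4 : k.1 ⬝ᵥ 1 = ∑ v, k.1 v := by simp [dotProduct]
  rw [h4, h1, h2]
  omega

theorem NegDef.isUnit_det {V : Type*} [Fintype V] [DecidableEq V] {Γ : PlumbingGraph V}
    (h : Γ.NegDef) : Γ.matrix.det ≠ 0 := by
  intro h0
  have h1 : IsUnit (Γ.matrix.map (Int.cast : ℤ → ℝ)) := by
    have := Matrix.PosDef.isUnit h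
    rwa [IsUnit.neg_iff] at this
  rw [Matrix.isUnit_iff_isUnit_det] at h1
  have h2 : (Γ.matrix.map (Int.cast : ℤ → ℝ)).det = ((Γ.matrix.det : ℤ) : ℝ) :=
    (Int.cast_det Γ.matrix).symm
  rw [h2, h0] at h1
  simp at h1

/-- The exponent of `q` in terms of `ℓ = 2 M x + k - M u`. -/
theorem qExp_eq {V : Type*} [Fintype V] [DecidableEq V] {Γ : PlumbingGraph V}
    (h : Γ.NegDef) (k x : V → ℤ) :
    Γ.qExp k x = -(3 * Fintype.card V + ∑ v, (Γ.weight v : ℚ)) / 4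
      - Γ.invSq (2 • Γ.matrix.mulVec x + Γ.shift k) / 4 := by
  set M : Matrix V V ℚ := Γ.matrix.map (Int.cast : ℤ → ℚ) with hM
  have hdet : IsUnit M.det := by
    have : M.det = ((Γ.matrix.det : ℤ) : ℚ) := (Int.cast_det Γ.matrix).symm
    rw [this, isUnit_iff_ne_zero]
    exact_mod_cast h.isUnit_det
  have hMt : M.transpose = M := by
    rw [hM, ← Matrix.transpose_map, matrix_transpose]
  have hcast : ∀ y : V → ℤ, (fun v => ((Γ.matrix.mulVec y v : ℤ) : ℚ))
      = M.mulVec (fun v => (y v : ℚ)) := by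
    intro y; ext v; simp [Matrix.mulVec, dotProduct, hM]
  have hdot : ∀ y z : V → ℤ, ((y ⬝ᵥ z : ℤ) : ℚ)
      = (fun v => (y v : ℚ)) ⬝ᵥ (fun v => (z v : ℚ)) := by
    intro y z; simp [dotProduct]
  have hform : ∀ y z : V → ℤ, ((Γ.form y z : ℤ) : ℚ)
      = (fun v => (y v : ℚ)) ⬝ᵥ M.mulVec (fun v => (z v : ℚ)) := by
    intro y z; rw [form, hdot, hcast]
  have hsymm : ∀ y z : V → ℚ, y ⬝ᵥ M.mulVec z = M.mulVec y ⬝ᵥ z := by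
    intro y z
    rw [Matrix.dotProduct_mulVec, ← Matrix.mulVec_transpose, hMt]
  have hsymm' : ∀ y z : V → ℚ, y ⬝ᵥ M⁻¹.mulVec z = M⁻¹.mulVec y ⬝ᵥ z := by
    intro y z
    rw [Matrix.dotProduct_mulVec, ← Matrix.mulVec_transpose, Matrix.transpose_nonsing_inv, hMt]
  have hinv : ∀ y : V → ℚ, M⁻¹.mulVec (M.mulVec y) = y := by
    intro y; rw [Matrix.mulVec_mulVec, Matrix.nonsing_inv_mul _ hdet, Matrix.one_mulVec]
  have hsh : (fun v => ((Γ.shift k v : ℤ) : ℚ))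
      = (fun v => (k v : ℚ)) - M.mulVec (fun v => (((1 : V → ℤ) v : ℤ) : ℚ)) := by
    rw [← hcast]; ext v; simp [shift]
  have hl : (fun v => (((2 • Γ.matrix.mulVec x + Γ.shift k) v : ℤ) : ℚ))
      = (2 : ℚ) • M.mulVec (fun v => (x v : ℚ)) + (fun v => ((Γ.shift k v : ℤ) : ℚ)) := by
    rw [← hcast]; ext v; simp
  have key : Γ.invSq (2 • Γ.matrix.mulVec x + Γ.shift k) = Γ.invSq (Γ.shift k)
      + 4 * Γ.form x x + 4 * ((k ⬝ᵥ x : ℤ) : ℚ) - 4 * Γ.form x 1 := by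
    simp only [invSq, invMatrix]
    rw [hl, ← hM]
    simp only [Matrix.mulVec_add, Matrix.mulVec_smul, hinv, add_dotProduct, dotProduct_add,
      smul_dotProduct, dotProduct_smul, smul_eq_mul]
    rw [hform, hform, hdot, hsymm' (M.mulVec (fun v => (x v : ℚ))), hinv, hsh]
    simp only [sub_dotProduct, dotProduct_sub]
    rw [hsymm _ (fun v => (((1 : V → ℤ) v : ℤ) : ℚ)), hsymm _ (fun v => (x v : ℚ)),
      dotProduct_comm (fun v => (x v : ℚ)) (fun v => (k v : ℚ)),
      dotProduct_comm (M.mulVec (fun v => (((1 : V → ℤ) v : ℤ) : ℚ))) (fun v => (x v : ℚ)),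
      hsymm (fun v => (x v : ℚ)) (fun v => (((1 : V → ℤ) v : ℤ) : ℚ))]
    ring
  rw [key, qExp, chi]
  push_cast
  ring

/-- For a negative definite plumbing matrix, finitely many terms of the series have an exponent of
`q` below a given bound. -/
theorem finite_qExp_le {V : Type*} [Fintype V] [DecidableEq V] {Γ : PlumbingGraph V}
    (h : Γ.NegDef) (k : V → ℤ) (e : ℚ) : {x : V → ℤ | Γ.qExp k x ≤ e}.Finite := by
  classical
  set B : Matrix V V ℝ := -(Γ.matrix.map (Int.cast : ℤ → ℝ)) with hB
  have hpos : ∀ y : V → ℝ, y ≠ 0 → 0 < y ⬝ᵥ B.mulVec y := fun y hy => by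
    simpa using Matrix.PosDef.dotProduct_mulVec_pos h hy
  have hcont : Continuous fun y : V → ℝ => y ⬝ᵥ B.mulVec y := by
    simp only [dotProduct, Matrix.mulVec]
    fun_prop
  obtain ⟨d, hd, hdle⟩ : ∃ d : ℝ, 0 < d ∧ ∀ y : V → ℝ, d * ‖y‖ ^ 2 ≤ y ⬝ᵥ B.mulVec y := by
    rcases (Metric.sphere (0 : V → ℝ) 1).eq_empty_or_nonempty with hE | hne
    · refine ⟨1, one_pos, fun y => ?_⟩
      by_cases hy : y = 0
      · simp [hy]
      · have : ‖y‖⁻¹ • y ∈ Metric.sphere (0 : V → ℝ) 1 := by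
          simp [norm_smul, norm_ne_zero_iff.mpr hy]
        rw [hE] at this
        exact this.elim
    · obtain ⟨y0, hy0, hmin⟩ := (isCompact_sphere (0 : V → ℝ) 1).exists_isMinOn hne
        hcont.continuousOn
      have hy0' : y0 ≠ 0 := by
        rintro rfl
        simp at hy0
      refine ⟨_, hpos y0 hy0', fun y => ?_⟩
      by_cases hy : y = 0
      · simp [hy]
      · have hn : ‖y‖ ≠ 0 := norm_ne_zero_iff.mpr hy
        have hmem : ‖y‖⁻¹ • y ∈ Metric.sphere (0 : V → ℝ) 1 := by
          simp [norm_smul, hn]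
        have := hmin hmem
        simp only [Set.mem_ofPred_eq, Matrix.mulVec_smul, smul_dotProduct, dotProduct_smul,
          smul_eq_mul] at this
        calc _ ≤ (‖y‖⁻¹ * (‖y‖⁻¹ * (y ⬝ᵥ B.mulVec y))) * ‖y‖ ^ 2 :=
              mul_le_mul_of_nonneg_right this (by positivity)
          _ = _ := by field_simp
  set w : V → ℤ := Γ.matrix.mulVec 1 - k with hw
  set K : ℝ := ∑ v, |(w v : ℝ)| with hK
  set C0 : ℚ := e + (Γ.invSq (Γ.shift k) + 3 * Fintype.card V + ∑ v, (Γ.weight v : ℚ)) / 4 with hC0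
  have hK0 : 0 ≤ K := Finset.sum_nonneg fun v _ => abs_nonneg _
  set b : ℝ := max 1 ((K + |(C0 : ℝ)|) / d) with hb
  have main : ∀ x : V → ℤ, Γ.qExp k x ≤ e → ∀ v, |(x v : ℝ)| ≤ b := by
    intro x hx v
    set y : V → ℝ := fun v => (x v : ℝ) with hy
    have h1 : ((Γ.form x x : ℤ) : ℝ) = -(y ⬝ᵥ B.mulVec y) := by
      simp [form, hB, hy, dotProduct, Matrix.mulVec]
    have h2 : -((k ⬝ᵥ x : ℤ) : ℝ) + ((Γ.form x 1 : ℤ) : ℝ) = ∑ v, (w v : ℝ) * y v := by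
      rw [dotProduct_comm]
      simp only [form, hw, hy, dotProduct]
      push_cast
      rw [← Finset.sum_neg_distrib, ← Finset.sum_add_distrib]
      refine Finset.sum_congr rfl fun v _ => ?_
      simp only [Pi.sub_apply]
      push_cast
      ring
    have h3 : -(K * ‖y‖) ≤ ∑ v, (w v : ℝ) * y v := by
      refine neg_le_of_abs_le ((Finset.abs_sum_le_sum_abs _ _).trans ?_)
      rw [hK, Finset.sum_mul]
      refine Finset.sum_le_sum fun v _ => ?_
      rw [abs_mul]
      exact mul_le_mul_of_nonneg_left (norm_le_pi_norm y v) (abs_nonneg _)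
    have h4 : -(k ⬝ᵥ x : ℤ) - (Γ.form x x : ℤ) + (Γ.form x 1 : ℤ) ≤ C0 := by
      rw [qExp, chi] at hx
      push_cast at hx ⊢
      linarith
    have h5 : -((k ⬝ᵥ x : ℤ) : ℝ) - ((Γ.form x x : ℤ) : ℝ) + ((Γ.form x 1 : ℤ) : ℝ) ≤ (C0 : ℝ) := by
      exact_mod_cast h4
    have h6 : d * ‖y‖ ^ 2 ≤ K * ‖y‖ + |(C0 : ℝ)| := by
      have := hdle y
      have := le_abs_self (C0 : ℝ)
      linarith
    refine (norm_le_pi_norm y v).trans ?_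
    rcases le_total ‖y‖ 1 with hy1 | hy1
    · exact hy1.trans (le_max_left _ _)
    · refine le_trans ?_ (le_max_right _ _)
      rw [le_div_iff₀ hd]
      have h7 : |(C0 : ℝ)| ≤ |(C0 : ℝ)| * ‖y‖ := le_mul_of_one_le_right (abs_nonneg _) hy1
      have h8 : (‖y‖ * d) * ‖y‖ ≤ (K + |(C0 : ℝ)|) * ‖y‖ := by nlinarith
      exact le_of_mul_le_mul_right h8 (by linarith)
  refine (Set.finite_Icc (fun _ : V => -⌈b⌉) (fun _ : V => ⌈b⌉)).subset fun x hx => ?_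
  have hx' := main x hx
  refine ⟨fun v => ?_, fun v => ?_⟩
  · have := (abs_le.mp ((hx' v).trans (Int.le_ceil b))).1
    exact_mod_cast this
  · have := (abs_le.mp ((hx' v).trans (Int.le_ceil b))).2
    exact_mod_cast this

/-- The series depends on the class of the characteristic vector only. -/
theorem seriesRep_congr {V : Type*} [Fintype V] [DecidableEq V] {R : Type*} [CommRing R]
    {Γ : PlumbingGraph V} (h : Γ.NegDef) (W : ℕ → ℤ → R) (k k' : Γ.CharVec)
    (hk : Γ.charSetoid k k') : Γ.seriesRep W k.1 = Γ.seriesRep W k'.1 := by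
  obtain ⟨y, hy⟩ := hk
  have hl : ∀ x, 2 • Γ.matrix.mulVec (x + y) + Γ.shift k.1
      = 2 • Γ.matrix.mulVec x + Γ.shift k'.1 := by
    intro x
    rw [shift, shift, hy, Matrix.mulVec_add, smul_add]
    abel
  have hq : ∀ x, Γ.qExp k.1 (x + y) = Γ.qExp k'.1 x := by
    intro x; rw [qExp_eq h, qExp_eq h, hl]
  have hw : ∀ x, Γ.coeffW W k.1 (x + y) = Γ.coeffW W k'.1 x := by
    intro x
    refine Finset.prod_congr rfl fun v _ => ?_
    have := congrFun (hl x) v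
    simp only [Pi.add_apply, nsmul_eq_mul, Nat.cast_ofNat, Pi.mul_apply,
      Pi.ofNat_apply] at this
    rw [this]
  have ht : ∀ x, Γ.theta k.1 + Γ.form (x + y) 1 = Γ.theta k'.1 + Γ.form x 1 := by
    intro x
    have h1 : k'.1 ⬝ᵥ 1 - Γ.form 1 1 = k.1 ⬝ᵥ 1 - Γ.form 1 1 + 2 * Γ.form y 1 := by
      rw [hy, form_comm Γ y 1, add_dotProduct, smul_dotProduct, form, form,
        dotProduct_comm (Γ.matrix.mulVec y)]
      simp only [nsmul_eq_mul, Nat.cast_ofNat]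
      ring
    rw [theta, theta, h1, Int.add_mul_ediv_left _ _ (by norm_num), form_add_left]
    ring
  ext1 e
  unfold seriesRep
  rw [← finsum_comp_equiv (Equiv.addRight y)]
  refine finsum_congr fun x => ?_
  simp only [Equiv.coe_addRight, hq, hw, ht]

theorem finite_spinC {V : Type*} [Fintype V] [DecidableEq V] {Γ : PlumbingGraph V}
    (h : Γ.NegDef) : Finite Γ.SpinC := by
  set d : ℤ := Γ.matrix.det with hd
  have hd0 : d ≠ 0 := h.isUnit_det
  have hfin : (Set.Icc (fun v => Γ.weight v) (fun v => Γ.weight v + 2 * |d|)).Finite :=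
    Set.finite_Icc _ _
  let S : Type _ := {k : Γ.CharVec // k.1 ∈ Set.Icc (fun v => Γ.weight v)
    (fun v => Γ.weight v + 2 * |d|)}
  have hS : Finite S := by
    have := hfin.to_subtype
    exact Finite.of_injective (β := Set.Icc (fun v => Γ.weight v) (fun v => Γ.weight v + 2 * |d|))
      (fun k => ⟨k.1.1, k.2⟩) fun k k' hkk => by
        have := congrArg Subtype.val hkk
        exact Subtype.ext (Subtype.ext this)
  refine Finite.of_surjective (α := S) (fun k => Quotient.mk Γ.charSetoid k.1) ?_
  intro κ
  induction κ using Quotient.inductionOn with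
  | h k =>
    choose w hw using fun v => (k.2 v).symm.dvd
    have hk : ∀ v, k.1 v = Γ.weight v + 2 * w v := fun v => by have := hw v; omega
    refine ⟨⟨⟨fun v => Γ.weight v + 2 * (w v % d), fun v => ?_⟩, fun v => ?_, fun v => ?_⟩,
      Quotient.sound ?_⟩
    · exact (Int.modEq_iff_dvd.mpr ⟨w v % d, by ring⟩ :
        Γ.weight v ≡ Γ.weight v + 2 * (w v % d) [ZMOD 2]).symm
    · have := Int.emod_nonneg (w v) hd0
      simp only
      linarith
    · have := (Int.emod_lt_abs (w v) hd0).le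
      simp only
      linarith
    · refine ⟨Γ.matrix.adjugate.mulVec fun v => w v / d, ?_⟩
      rw [Matrix.mulVec_mulVec, Matrix.mul_adjugate, Matrix.smul_mulVec, Matrix.one_mulVec]
      ext v
      have := Int.emod_add_mul_ediv (w v) d
      simp only [Pi.add_apply, Pi.smul_apply, smul_eq_mul, nsmul_eq_mul, Nat.cast_ofNat, hk v,
        Pi.mul_apply, Pi.ofNat_apply, ← hd]
      linarith

/-- The series `P_{W,[k]}` of a spin^c structure `[k]`. -/
noncomputable def series {V : Type*} [Fintype V] [DecidableEq V] {R : Type*} [CommRing R]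
    (Γ : PlumbingGraph V) (h : Γ.NegDef) (W : ℕ → ℤ → R) (κ : Γ.SpinC) : TQSeries R :=
  Quotient.lift (fun k : Γ.CharVec => Γ.seriesRep W k.1) (seriesRep_congr h W) κ

/-- The series `P_{W,0}`: the sum of the series of all the spin^c structures (a finite set, see
`finite_spinC`). -/
noncomputable def totalSeries {V : Type*} [Fintype V] [DecidableEq V] {R : Type*} [CommRing R]
    (Γ : PlumbingGraph V) (h : Γ.NegDef) (W : ℕ → ℤ → R) : TQSeries R :=
  ∑ᶠ κ : Γ.SpinC, Γ.series h W κ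

end PlumbingGraph

/-! ## Seifert manifolds -/

/-- The continued fraction `c 0 - 1 / (c 1 - 1 / (⋯ - 1 / c n))`. -/
def contFrac : (n : ℕ) → (Fin (n + 1) → ℤ) → ℚ
  | 0, c => c 0
  | n + 1, c => c 0 - 1 / contFrac n (Fin.tail c)

/-- Vertices of a star-shaped graph with `k` legs of lengths `n i + 1`: the node `none`, and the
vertices `some ⟨i, j⟩` of the legs, counted from the node outwards. -/
abbrev StarVertex {k : ℕ} (n : Fin k → ℕ) : Type := Option (Σ i : Fin k, Fin (n i + 1))

/-- The star-shaped graph: the node is joined to the first vertex of each leg, consecutive vertices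
of a leg are joined. -/
def starGraph {k : ℕ} (n : Fin k → ℕ) : SimpleGraph (StarVertex n) :=
  SimpleGraph.fromRel fun v w =>
    match v, w with
    | none, some q => q.2 = 0
    | some p, some q => p.1 = q.1 ∧ (q.2 : ℕ) = p.2 + 1
    | _, none => False

/-- The star-shaped plumbing graph with node of weight `-b` and leg vertices of weights
`-c i j`. -/
def seifertPlumbing {k : ℕ} (b : ℤ) (n : Fin k → ℕ) (c : (i : Fin k) → Fin (n i + 1) → ℤ) :
    PlumbingGraph (StarVertex n) where
  graph := starGraph n
  weight v := match v with
    | none => -b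
    | some p => -c p.1 p.2

/-- The leaf at the end of the `i`-th leg. -/
def starLeaf {k : ℕ} (n : Fin k → ℕ) (i : Fin k) : StarVertex n := some ⟨i, Fin.last (n i)⟩

/-- `A = a_1 ⋯ a_k`. -/
def fiberProd {k : ℕ} (a : Fin k → ℤ) : ℤ := ∏ i, a i

/-- `A / a_i`, the product of the other `a_j`. -/
def fiberProdOther {k : ℕ} (a : Fin k → ℤ) (i : Fin k) : ℤ := ∏ j ∈ Finset.univ.erase i, a j

/-- The factor `z ^ p * t⁻¹ - z ^ (-p) * t`, a Laurent polynomial in `z` over the Laurent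
polynomials in `t`. -/
noncomputable def seifertFactor (R : Type*) [CommRing R] (p : ℤ) : R[T;T⁻¹][T;T⁻¹] :=
  C (T (-1)) * T p - C (T 1) * T (-p)

/-- The numerator `∏ i, (z ^ (A / a_i) * t⁻¹ - z ^ (-A / a_i) * t)` of `f_0`. -/
noncomputable def f0Num (R : Type*) [CommRing R] {k : ℕ} (a : Fin k → ℤ) : R[T;T⁻¹][T;T⁻¹] :=
  ∏ i, seifertFactor R (fiberProdOther a i)

/-- The denominator `(z ^ A * t⁻¹ - z ^ (-A) * t) ^ (k - 2)` of `f_0`. -/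
noncomputable def f0Den (R : Type*) [CommRing R] {k : ℕ} (a : Fin k → ℤ) : R[T;T⁻¹][T;T⁻¹] :=
  seifertFactor R (fiberProd a) ^ (k - 2)

theorem isUnit_single_add_single {S : Type*} [CommRing S] {p q : ℤ} (hpq : p < q) (u : Sˣ) (v : S) :
    IsUnit (HahnSeries.single p (u : S) + HahnSeries.single q v : LaurentSeries S) := by
  have h1 : (HahnSeries.single p (u : S) + HahnSeries.single q v : LaurentSeries S)
      = HahnSeries.single p (u : S) * (1 + HahnSeries.single (q - p) ((u⁻¹ : Sˣ) * v)) := by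
    rw [mul_add, mul_one, HahnSeries.single_mul_single]
    simp
  rw [h1]
  refine IsUnit.mul (IsUnit.of_mul_eq_one (HahnSeries.single (-p) ((u⁻¹ : Sˣ) : S)) ?_)
    (HahnSeries.isUnit_of_orderTop_pos ?_)
  · rw [HahnSeries.single_mul_single]
    simp
  · rw [add_sub_cancel_left]
    exact lt_of_lt_of_le (WithTop.coe_pos.mpr (sub_pos.mpr hpq)) HahnSeries.orderTop_single_le

theorem toLaurentSeries_T {S : Type*} [CommRing S] (p : ℤ) :
    toLaurentSeries (T p : S[T;T⁻¹]) = HahnSeries.single p 1 := by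
  have h1 : ∀ m : ℤ, ((laurentX S ^ m : (LaurentSeries S)ˣ) : LaurentSeries S)
      = HahnSeries.single m 1 := by
    intro m
    induction m with
    | zero => simp
    | succ i ih =>
      rw [zpow_add_one, Units.val_mul, ih, laurentX, HahnSeries.single_mul_single, one_mul]
    | pred i ih =>
      rw [zpow_sub_one, Units.val_mul, ih, laurentX, Units.inv_mk, HahnSeries.single_mul_single,
        one_mul, sub_eq_add_neg]
  rw [toLaurentSeries, LaurentPolynomial.eval₂_T, h1]

/-- The denominator of `f_0` is invertible in the Laurent series in `z` and in `z⁻¹`. -/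
theorem isUnit_f0Den (R : Type*) [CommRing R] {k : ℕ} (a : Fin k → ℤ) (ha : 0 < fiberProd a) :
    IsUnit (toLaurentSeries (f0Den R a)) ∧
      IsUnit (toLaurentSeries (LaurentPolynomial.invert (f0Den R a))) := by
  have hT : ∀ m : ℤ, IsUnit (T m : R[T;T⁻¹]) := LaurentPolynomial.isUnit_T
  have hC : ∀ (r : R[T;T⁻¹]) (m : ℤ),
      toLaurentSeries (C r * T m : R[T;T⁻¹][T;T⁻¹]) = HahnSeries.single m r := by
    intro r m
    rw [map_mul, toLaurentSeries_T, toLaurentSeries, LaurentPolynomial.eval₂_C,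
      HahnSeries.C_apply, HahnSeries.single_mul_single, zero_add, mul_one]
  have hneg : -fiberProd a < fiberProd a := by omega
  constructor
  · rw [f0Den, map_pow]
    refine IsUnit.pow _ ?_
    rw [seifertFactor, map_sub, hC, hC]
    have := isUnit_single_add_single hneg (hT 1).unit (-T (-1))
    rw [HahnSeries.single_neg, ← sub_eq_add_neg, IsUnit.unit_spec] at this
    rw [← neg_sub]
    exact this.neg
  · rw [f0Den, map_pow, map_pow]
    refine IsUnit.pow _ ?_
    rw [seifertFactor, map_sub, map_mul, map_mul, LaurentPolynomial.invert_T,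
      LaurentPolynomial.invert_T, LaurentPolynomial.invert_C, LaurentPolynomial.invert_C, neg_neg,
      map_sub, hC, hC]
    have := isUnit_single_add_single hneg (hT (-1)).unit (-T 1)
    rwa [HahnSeries.single_neg, ← sub_eq_add_neg, IsUnit.unit_spec] at this

/-- The exponent `Δ` of the prefactor: with `s` vertices, weights `m v` and leaves `v_i`,
`4 Δ = -|H| (3 s + ∑ v, m v) + ∑ i, (-|H| (M⁻¹) v_i v_i - A / a_i ^ 2)`. -/
noncomputable def seifertDelta {k : ℕ} (b : ℤ) (a : Fin k → ℤ) (n : Fin k → ℕ)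
    (c : (i : Fin k) → Fin (n i + 1) → ℤ) : ℚ :=
  let Γ := seifertPlumbing b n c
  (-(Γ.orderH1 : ℚ) * (3 * Fintype.card (StarVertex n) + ∑ v, (Γ.weight v : ℚ))
    + ∑ i, (-(Γ.orderH1 : ℚ) * Γ.invMatrix (starLeaf n i) (starLeaf n i)
      - (fiberProd a : ℚ) / (a i : ℚ) ^ 2)) / 4

/-! Put `l = 2Mx + k - Mu`. As `[k]` runs over the spin^c structures and `x` over the lattice, `l`
runs exactly once over the covectors with `l v ≡ δ v` mod 2, and both exponents depend on `l` alone: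
`t` has half the sum of the entries of `l`, and `q` has a constant minus `l² / 4` (`range_covec`,
`NegDef.covec_injective`, `totalSeries_apply`). Since `W 2` is supported at `0` and `W 1` at `±1`,
only the covectors with an odd `r` at the node, signs `ε i` at the leaves and `0` elsewhere survive
(`exists_starCovec_of_prod_ne_zero`). On odd integers `W 3` takes the value `W 3 1` to the right of
`0` and `W 3 1 - 1` to the left (`IsAdmissible.three_odd`).

The entries of `-|H| M⁻¹` are `A` at the node, `A / a i` between node and leaf, `A / (a i * a j)`
between distinct leaves. Up to a diagonal correction this is a rank one form, so `-|H| l²` is `A (r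
+ ∑ ε i / a i)²` plus a constant, and the constants add up to `Δ`
(`orderH1_mul_covecExp_starCovec`).

On the other side, the numerator of `f_0` is a sum over the same signs `ε`, and the asymmetric
expansion of the inverse of the denominator has coefficient `y t^r` or `(y - 1) t^r` at `z^(-A r)`,
for odd `r > 0` or `r < 0` (`asymExpansion_one_binomial`). With `y = W 3 1` the two sums agree term
by term. -/

/-! ### Expansions of the inverse of a binomial -/

/-- The coefficient of `z ^ m` in `∑ z ^ (p * j) * v ^ (-j)` over the odd integers `j > 0`. -/
noncomputable def oddGeom {S : Type*} [CommRing S] (p : ℤ) (v : Sˣ) (m : ℤ) : S :=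
  if p ∣ m ∧ Odd (m / p) ∧ 0 < m / p then ((v ^ (-(m / p)) : Sˣ) : S) else 0

theorem oddGeom_mul {S : Type*} [CommRing S] {p : ℤ} (hp : 0 < p) (v : Sˣ) (j : ℤ) :
    oddGeom p v (p * j) = if Odd j ∧ 0 < j then ((v ^ (-j) : Sˣ) : S) else 0 := by
  simp [oddGeom, Int.mul_ediv_cancel_left _ hp.ne']

theorem oddGeom_of_not_dvd {S : Type*} [CommRing S] {p m : ℤ} (h : ¬p ∣ m) (v : Sˣ) :
    oddGeom p v m = 0 := if_neg fun h' => h h'.1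

/-- This is `(v⁻¹ z^p - v z^(-p)) * ∑ = -1` read at `z^n`. The two neighbouring terms cancel, except
at `n = 0`, where only the neighbour `j = 1` lies in the range `j > 0`. -/
theorem oddGeom_rec {S : Type*} [CommRing S] {p : ℤ} (hp : 0 < p) (v : Sˣ) (n : ℤ) :
    ((v⁻¹ : Sˣ) : S) * oddGeom p v (n - p) - v * oddGeom p v (n + p)
      = if n = 0 then -1 else 0 := by
  by_cases h : p ∣ n
  · obtain ⟨j, rfl⟩ := h
    rw [show p * j - p = p * (j - 1) by ring, show p * j + p = p * (j + 1) by ring,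
      oddGeom_mul hp, oddGeom_mul hp]
    have h1 : ((v⁻¹ : Sˣ) : S) * ((v ^ (-(j - 1)) : Sˣ) : S) = ((v ^ (-j) : Sˣ) : S) := by
      rw [← Units.val_mul, neg_sub, sub_eq_add_neg, zpow_one_add, inv_mul_cancel_left]
    have h2 : (v : S) * ((v ^ (-(j + 1)) : Sˣ) : S) = ((v ^ (-j) : Sˣ) : S) := by
      rw [← Units.val_mul, neg_add_rev, zpow_add, zpow_neg_one, mul_inv_cancel_left]
    by_cases hj : Even j
    · have e1 : Odd (j - 1) := hj.sub_odd odd_one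
      have e2 : Odd (j + 1) := hj.add_odd odd_one
      rcases lt_trichotomy j 0 with h0 | h0 | h0
      · rw [if_neg (by omega), if_neg (by omega), if_neg]
        · simp
        · exact (mul_neg_of_pos_of_neg hp h0).ne
      · subst h0
        simp
      -- An even `j > 0` is at least `2`, so both `j - 1` and `j + 1` are in the range.
      · obtain ⟨i, hi⟩ := hj
        rw [if_pos ⟨e1, by omega⟩, if_pos ⟨e2, by omega⟩, if_neg (mul_pos hp h0).ne', h1, h2,
          sub_self]
    · have e1 : ¬Odd (j - 1) := fun h' => hj (by simpa using h'.add_odd odd_one)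
      have e2 : ¬Odd (j + 1) := fun h' => hj (by simpa using h'.sub_odd odd_one)
      have e3 : p * j ≠ 0 := by
        refine mul_ne_zero hp.ne' ?_
        rintro rfl
        exact hj Even.zero
      simp [e1, e2, e3]
  · rw [oddGeom_of_not_dvd, oddGeom_of_not_dvd, if_neg]
    · simp
    · rintro rfl
      exact h (dvd_zero p)
    · simpa using h
    · simpa using h

theorem bddBelow_support_oddGeom {S : Type*} [CommRing S] {p : ℤ} (hp : 0 < p) (v : Sˣ) :
    BddBelow (Function.support (oddGeom p v)) := by
  refine ⟨0, fun m hm => ?_⟩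
  by_contra hm0
  refine hm (if_neg fun h => ?_)
  have := Int.ediv_neg_of_neg_of_pos (not_le.mp hm0) hp
  omega

theorem toLaurentSeries_C_mul_T {S : Type*} [CommRing S] (r : S) (m : ℤ) :
    toLaurentSeries (C r * T m : S[T;T⁻¹]) = HahnSeries.single m r := by
  rw [map_mul, toLaurentSeries_T, toLaurentSeries, LaurentPolynomial.eval₂_C,
    HahnSeries.C_apply, HahnSeries.single_mul_single, zero_add, mul_one]

theorem coeff_single_mul_laurent {S : Type*} [CommRing S] (r : S) (m n : ℤ) (x : LaurentSeries S) :
    (HahnSeries.single m r * x).coeff n = r * x.coeff (n - m) := by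
  conv_lhs => rw [← sub_add_cancel n m]
  exact HahnSeries.coeff_single_mul_add

theorem ringInverse_eq_of_mul_eq_one {M : Type*} [CommRing M] {x y : M} (h : x * y = 1) :
    Ring.inverse x = y := by
  have hx : IsUnit x := IsUnit.of_mul_eq_one y h
  rw [← mul_one (Ring.inverse x), ← h, ← mul_assoc, Ring.inverse_mul_cancel x hx, one_mul]

theorem ringInverse_neg {M : Type*} [CommRing M] (x : M) : Ring.inverse (-x) = -Ring.inverse x := by
  by_cases hx : IsUnit x
  · refine ringInverse_eq_of_mul_eq_one ?_
    rw [neg_mul_neg, Ring.mul_inverse_cancel x hx]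
  · rw [Ring.inverse_non_unit x hx, Ring.inverse_non_unit (-x) (by rwa [IsUnit.neg_iff]), neg_zero]

theorem inverse_toLaurentSeries_binomial {S : Type*} [CommRing S] {p : ℤ} (hp : 0 < p) (v : Sˣ) :
    Ring.inverse (toLaurentSeries (C ((v⁻¹ : Sˣ) : S) * T p - C (v : S) * T (-p)))
      = -HahnSeries.ofSuppBddBelow (oddGeom p v) (bddBelow_support_oddGeom hp v) := by
  refine ringInverse_eq_of_mul_eq_one ?_
  rw [map_sub, toLaurentSeries_C_mul_T, toLaurentSeries_C_mul_T]
  ext n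
  rw [mul_neg, HahnSeries.coeff_neg, sub_mul, HahnSeries.coeff_sub, coeff_single_mul_laurent,
    coeff_single_mul_laurent, sub_neg_eq_add]
  change -(_ * oddGeom p v _ - _ * oddGeom p v _) = _
  rw [oddGeom_rec hp, HahnSeries.coeff_one]
  split_ifs <;> simp

theorem expansionZero_one_binomial {S : Type*} [CommRing S] {p : ℤ} (hp : 0 < p) (v : Sˣ) (m : ℤ) :
    expansionZero 1 (C ((v⁻¹ : Sˣ) : S) * T p - C (v : S) * T (-p)) m = -oddGeom p v m := by
  rw [expansionZero, map_one, one_mul, inverse_toLaurentSeries_binomial hp]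
  rfl

/-- Inverting `z` swaps the two terms, which gives minus the binomial of `v⁻¹`. The expansion at `∞`
thus comes from the same series as the one at `0`, with the opposite sign. -/
theorem expansionInfty_one_binomial {S : Type*} [CommRing S] {p : ℤ} (hp : 0 < p) (v : Sˣ)
    (m : ℤ) :
    expansionInfty 1 (C ((v⁻¹ : Sˣ) : S) * T p - C (v : S) * T (-p)) m = oddGeom p v⁻¹ (-m) := by
  have h : LaurentPolynomial.invert (C ((v⁻¹ : Sˣ) : S) * T p - C (v : S) * T (-p))
      = -(C (((v⁻¹)⁻¹ : Sˣ) : S) * T p - C ((v⁻¹ : Sˣ) : S) * T (-p)) := by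
    simp
  rw [expansionInfty, h, expansionZero, map_one, map_one, one_mul, map_neg, ringInverse_neg,
    inverse_toLaurentSeries_binomial hp, neg_neg]
  rfl

theorem expansionZero_sum {S ι : Type*} [CommRing S] (s : Finset ι) (f : ι → S) (m : ι → ℤ)
    (D : S[T;T⁻¹]) (n : ℤ) :
    expansionZero (∑ i ∈ s, C (f i) * T (m i)) D n = ∑ i ∈ s, f i * expansionZero 1 D (n - m i) := by
  simp only [expansionZero, map_sum, toLaurentSeries_C_mul_T, Finset.sum_mul, HahnSeries.coeff_sum,
    coeff_single_mul_laurent, map_one, one_mul]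

theorem expansionInfty_sum {S ι : Type*} [CommRing S] (s : Finset ι) (f : ι → S) (m : ι → ℤ)
    (D : S[T;T⁻¹]) (n : ℤ) :
    expansionInfty (∑ i ∈ s, C (f i) * T (m i)) D n
      = ∑ i ∈ s, f i * expansionInfty 1 D (n - m i) := by
  have h : LaurentPolynomial.invert (∑ i ∈ s, C (f i) * T (m i))
      = ∑ i ∈ s, C (f i) * T (-m i) := by simp
  simp only [expansionInfty, h, expansionZero_sum, map_one]
  refine Finset.sum_congr rfl fun i _ => ?_
  rw [neg_sub, sub_neg_eq_add, neg_add_eq_sub]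

theorem asymExpansion_sum {R S ι : Type*} [CommRing R] [CommRing S] [Algebra R S] (y : R)
    (s : Finset ι) (f : ι → S) (m : ι → ℤ) (D : S[T;T⁻¹]) (n : ℤ) :
    asymExpansion y (∑ i ∈ s, C (f i) * T (m i)) D n
      = ∑ i ∈ s, f i * asymExpansion y 1 D (n - m i) := by
  simp only [asymExpansion, expansionZero_sum, expansionInfty_sum, Finset.smul_sum,
    ← Finset.sum_add_distrib, mul_add, mul_smul_comm]

theorem symExpansion_eq_asymExpansion {R S : Type*} [CommRing R] [CommRing S] [Algebra R S]
    [Invertible (2 : R)] (N D : S[T;T⁻¹]) (n : ℤ) :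
    symExpansion R N D n = asymExpansion (⅟(2 : R)) N D n := by
  have h : (1 : R) - ⅟2 = ⅟2 := by
    linear_combination -(mul_invOf_self (2 : R))
  rw [symExpansion, asymExpansion, h]

/-- The sign of `r` selects the expansion that contributes: the one at `∞`, of weight `y`, for `r >
0`, and the one at `0`, of weight `1 - y` and sign `-1`, for `r < 0`. The scalars are those of
`IsAdmissible.three_odd`. -/
theorem asymExpansion_one_binomial {R S : Type*} [CommRing R] [CommRing S] [Algebra R S] (y : R)
    {p : ℤ} (hp : 0 < p) (v : Sˣ) {r : ℤ} (hr : Odd r) :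
    asymExpansion y 1 (C ((v⁻¹ : Sˣ) : S) * T p - C (v : S) * T (-p)) (-(p * r))
      = (if 0 < r then y else y - 1) • ((v ^ r : Sˣ) : S) := by
  rw [asymExpansion, expansionZero_one_binomial hp, expansionInfty_one_binomial hp, neg_neg,
    ← mul_neg, oddGeom_mul hp, oddGeom_mul hp]
  have hr0 : r ≠ 0 := by
    rintro rfl
    simp at hr
  rcases lt_or_gt_of_ne hr0 with h | h
  · rw [if_pos ⟨hr.neg, by omega⟩, if_neg (by omega), if_neg (by omega), neg_neg, smul_zero,
      add_zero, smul_neg, ← neg_smul, neg_sub]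
  · rw [if_neg (by omega), if_pos ⟨hr, h⟩, if_pos h, neg_zero, smul_zero, zero_add, inv_zpow',
      neg_neg]

theorem asymExpansion_one_binomial_eq_zero {R S : Type*} [CommRing R] [CommRing S] [Algebra R S]
    (y : R) {p : ℤ} (hp : 0 < p) (v : Sˣ) {m : ℤ} (hm : ∀ r, Odd r → m ≠ -(p * r)) :
    asymExpansion y 1 (C ((v⁻¹ : Sˣ) : S) * T p - C (v : S) * T (-p)) m = 0 := by
  rw [asymExpansion, expansionZero_one_binomial hp, expansionInfty_one_binomial hp]
  by_cases h : p ∣ m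
  · obtain ⟨j, rfl⟩ := h
    have hj : ¬Odd j := fun hj => hm (-j) hj.neg (by ring)
    rw [← mul_neg, oddGeom_mul hp, oddGeom_mul hp]
    simp [hj]
  · rw [oddGeom_of_not_dvd h, oddGeom_of_not_dvd (by simpa using h)]
    simp

/-! ### The family `Ŵ` -/

/-- This is `x * x^(2-d) = x^(2-(d-1))` with truncated exponents: the factor joins the numerator for
`d ≤ 2` and cancels in the denominator for `d ≥ 3`. The case `d = 0` is excluded because `d - 1`
truncates there. -/
theorem toLaurentSeries_mul_pow_div_pow {S : Type*} [CommRing S] (x : S[T;T⁻¹])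
    (hx : IsUnit (toLaurentSeries x)) {d : ℕ} (hd : 1 ≤ d) :
    toLaurentSeries x
        * (toLaurentSeries (x ^ (2 - d)) * Ring.inverse (toLaurentSeries (x ^ (d - 2))))
      = toLaurentSeries (x ^ (2 - (d - 1)))
        * Ring.inverse (toLaurentSeries (x ^ (d - 1 - 2))) := by
  rcases le_or_gt d 2 with h | h
  · rw [show d - 2 = 0 by omega, show d - 1 - 2 = 0 by omega, show 2 - (d - 1) = 2 - d + 1 by omega,
      pow_succ, map_mul]
    simp [mul_comm]
  · obtain ⟨e, rfl⟩ : ∃ e, d = e + 3 := ⟨d - 3, by omega⟩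
    rw [show e + 3 - 2 = e + 1 by omega, show e + 3 - 1 - 2 = e by omega,
      show 2 - (e + 3) = 0 by omega, show 2 - (e + 3 - 1) = 0 by omega, pow_zero, map_one, one_mul,
      one_mul, pow_succ', map_mul, Ring.mul_inverse_rev, mul_comm (Ring.inverse _), ← mul_assoc,
      Ring.mul_inverse_cancel _ hx, one_mul]

theorem isUnit_toLaurentSeries_T_sub_T {S : Type*} [CommRing S] :
    IsUnit (toLaurentSeries (T 1 - T (-1) : S[T;T⁻¹])) := by
  have := isUnit_single_add_single (S := S) (p := -1) (q := 1) (by norm_num) (-1) 1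
  rw [map_sub, toLaurentSeries_T, toLaurentSeries_T, sub_eq_neg_add, ← HahnSeries.single_neg]
  rwa [Units.val_neg, Units.val_one] at this

theorem expansionZero_pow_T_sub_T {S : Type*} [CommRing S] {d : ℕ} (hd : 1 ≤ d) (n : ℤ) :
    expansionZero ((T 1 - T (-1) : S[T;T⁻¹]) ^ (2 - (d - 1))) ((T 1 - T (-1)) ^ (d - 1 - 2)) n
      = expansionZero ((T 1 - T (-1) : S[T;T⁻¹]) ^ (2 - d)) ((T 1 - T (-1)) ^ (d - 2)) (n - 1)
        - expansionZero ((T 1 - T (-1) : S[T;T⁻¹]) ^ (2 - d)) ((T 1 - T (-1)) ^ (d - 2)) (n + 1) := by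
  rw [expansionZero, ← toLaurentSeries_mul_pow_div_pow _ isUnit_toLaurentSeries_T_sub_T hd]
  nth_rw 1 [map_sub, toLaurentSeries_T, toLaurentSeries_T]
  rw [sub_mul, HahnSeries.coeff_sub, coeff_single_mul_laurent, coeff_single_mul_laurent, one_mul,
    one_mul, sub_neg_eq_add]
  rfl

/-- `z - z⁻¹` changes sign under `z ↦ z⁻¹`, so each of the `i + j` factors contributes `-1`. -/
theorem expansionInfty_pow_T_sub_T {S : Type*} [CommRing S] (i j : ℕ) (n : ℤ) :
    expansionInfty ((T 1 - T (-1) : S[T;T⁻¹]) ^ i) ((T 1 - T (-1)) ^ j) n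
      = (-1) ^ (i + j) * expansionZero ((T 1 - T (-1) : S[T;T⁻¹]) ^ i) ((T 1 - T (-1)) ^ j) (-n) := by
  have h : LaurentPolynomial.invert (T 1 - T (-1) : S[T;T⁻¹]) = -(T 1 - T (-1)) := by simp
  have h2 : ∀ (j : ℕ) (x : LaurentSeries S),
      Ring.inverse ((-1) ^ j * x) = (-1) ^ j * Ring.inverse x := by
    intro j x
    rcases neg_one_pow_eq_or (LaurentSeries S) j with h | h <;> simp [h, ringInverse_neg]
  have h3 : ∀ (i j : ℕ) (x y : LaurentSeries S), ((-1) ^ i * x * ((-1) ^ j * y)).coeff (-n)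
      = (-1) ^ (i + j) * (x * y).coeff (-n) := by
    intro i j x y
    rw [mul_mul_mul_comm, ← pow_add]
    rcases Nat.even_or_odd (i + j) with h | h <;> simp [h.neg_one_pow]
  rw [expansionInfty, map_pow, map_pow, h, neg_pow, neg_pow _ j, expansionZero, expansionZero,
    map_mul, map_mul, map_pow _ (-1), map_pow _ (-1), map_neg, map_one, h2, h3]

theorem wHat_eq {R : Type*} [CommRing R] [Invertible (2 : R)] (d : ℕ) (n : ℤ) :
    WHat R d n = ⅟2 * (
      expansionZero ((T 1 - T (-1) : R[T;T⁻¹]) ^ (2 - d)) ((T 1 - T (-1)) ^ (d - 2)) (-n)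
      + (-1) ^ d * expansionZero ((T 1 - T (-1) : R[T;T⁻¹]) ^ (2 - d)) ((T 1 - T (-1)) ^ (d - 2)) n) := by
  have h : (-1 : R) ^ (2 - d + (d - 2)) = (-1) ^ d := by
    rcases le_or_gt d 2 with h | h
    · interval_cases d <;> simp
    · obtain ⟨e, rfl⟩ : ∃ e, d = e + 2 := ⟨d - 2, by omega⟩
      rw [show 2 - (e + 2) = 0 by omega, show e + 2 - 2 = e by omega, zero_add, pow_add]
      simp
  rw [WHat, symExpansion, expansionInfty_pow_T_sub_T, h, neg_neg, smul_eq_mul, smul_eq_mul, mul_add]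

theorem isAdmissible_wHat (R : Type*) [CommRing R] [Invertible (2 : R)] :
    IsAdmissible (WHat R) := by
  have h2 : ∀ r, WHat R 2 r = if r = 0 then 1 else 0 := by
    intro r
    rw [wHat_eq]
    simp only [expansionZero, Nat.sub_self, pow_zero, map_one, Ring.inverse_one, mul_one,
      HahnSeries.coeff_one, neg_eq_zero]
    split_ifs
    · simp [one_add_one_eq_two]
    · simp
  refine ⟨by simp [h2], fun r hr => by simp [h2, hr], fun d hd r => ?_⟩
  -- The step relation expresses multiplication by `z - z⁻¹`, which lowers `d` by one and acts on
  -- coefficients as a difference.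
  obtain ⟨e, rfl⟩ : ∃ e, d = e + 1 := ⟨d - 1, by omega⟩
  rw [wHat_eq, wHat_eq, wHat_eq, expansionZero_pow_T_sub_T hd, expansionZero_pow_T_sub_T hd,
    Nat.add_sub_cancel, pow_succ, neg_add, neg_sub, ← sub_eq_add_neg, sub_eq_neg_add 1 r]
  ring

theorem wHat_three_one (R : Type*) [CommRing R] [Invertible (2 : R)] : WHat R 3 1 = ⅟2 := by
  have := asymExpansion_one_binomial (⅟(2 : R)) one_pos (1 : Rˣ) odd_one
  rw [WHat, symExpansion_eq_asymExpansion]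
  norm_num at this ⊢
  exact this

/-! ## Chains -/

/-- Numerator and denominator of the continued fraction `contFrac n c`. -/
def continuants : (n : ℕ) → (Fin (n + 1) → ℤ) → ℤ × ℤ
  | 0, c => (c 0, 1)
  | n + 1, c =>
    (c 0 * (continuants n (Fin.tail c)).1 - (continuants n (Fin.tail c)).2,
      (continuants n (Fin.tail c)).1)

/-- The tridiagonal matrix with diagonal `c` and entries `-1` next to the diagonal. -/
def chainMatrix {n : ℕ} (c : Fin (n + 1) → ℤ) : Matrix (Fin (n + 1)) (Fin (n + 1)) ℤ :=
  Matrix.of fun j k =>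
    if j = k then c j else if (k : ℕ) = j + 1 ∨ (j : ℕ) = k + 1 then -1 else 0

theorem chainMatrix_zero_zero {n : ℕ} (c : Fin (n + 1) → ℤ) : chainMatrix c 0 0 = c 0 := by
  simp [chainMatrix]

theorem chainMatrix_zero_succ {n : ℕ} (c : Fin (n + 2) → ℤ) (k : Fin (n + 1)) :
    chainMatrix c 0 k.succ = if k = 0 then -1 else 0 := by
  rw [chainMatrix, Matrix.of_apply, if_neg (Fin.succ_ne_zero k).symm]
  refine if_congr ?_ rfl rfl
  rw [Fin.val_succ, Fin.ext_iff, Fin.val_zero, Fin.val_zero]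
  omega

theorem chainMatrix_succ_zero {n : ℕ} (c : Fin (n + 2) → ℤ) (k : Fin (n + 1)) :
    chainMatrix c k.succ 0 = if k = 0 then -1 else 0 := by
  rw [chainMatrix, Matrix.of_apply, if_neg (Fin.succ_ne_zero k)]
  refine if_congr ?_ rfl rfl
  rw [Fin.val_succ, Fin.ext_iff, Fin.val_zero, Fin.val_zero]
  omega

theorem chainMatrix_succ_succ {n : ℕ} (c : Fin (n + 2) → ℤ) (j k : Fin (n + 1)) :
    chainMatrix c j.succ k.succ = chainMatrix (Fin.tail c) j k := by
  simp [chainMatrix, Fin.tail]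

theorem chainMatrix_submatrix_succ {n : ℕ} (c : Fin (n + 2) → ℤ) :
    (chainMatrix c).submatrix Fin.succ Fin.succ = chainMatrix (Fin.tail c) := by
  ext j k
  exact chainMatrix_succ_succ c j k

/-- Expansion along the first row, then along the first column of the second minor, gives the
three-term recursion that defines the continuants. -/
theorem det_chainMatrix : ∀ (n : ℕ) (c : Fin (n + 1) → ℤ),
    (chainMatrix c).det = (continuants n c).1
  | 0, c => by simp [continuants, chainMatrix]
  | 1, c => by
    rw [Matrix.det_fin_two]
    simp [continuants, chainMatrix, Fin.tail]
  | n + 2, c => by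
    rw [Matrix.det_succ_row_zero, Fin.sum_univ_succ, Fin.sum_univ_succ, Finset.sum_eq_zero]
    · have h1 : ((chainMatrix c).submatrix Fin.succ (Fin.succAbove (Fin.succ 0))).det
          = -(chainMatrix (Fin.tail (Fin.tail c))).det := by
        rw [Matrix.det_succ_column_zero, Fin.sum_univ_succ, Finset.sum_eq_zero]
        · have h2 : (((chainMatrix c).submatrix Fin.succ (Fin.succAbove (Fin.succ 0))).submatrix
              (Fin.succAbove 0) Fin.succ) = chainMatrix (Fin.tail (Fin.tail c)) := by
            ext j k
            simp only [Matrix.submatrix_apply, Fin.succ_succAbove_succ, Fin.zero_succAbove,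
              chainMatrix_succ_succ]
          rw [h2, Matrix.submatrix_apply, Fin.succ_succAbove_zero, chainMatrix_succ_zero]
          simp
        · intro i _
          rw [Matrix.submatrix_apply, Fin.succ_succAbove_zero, chainMatrix_succ_zero]
          simp [Fin.succ_ne_zero]
      rw [h1, Fin.succAbove_zero, chainMatrix_submatrix_succ, chainMatrix_zero_zero,
        chainMatrix_zero_succ, det_chainMatrix, det_chainMatrix]
      simp [continuants]
      ring
    · intro i _
      rw [chainMatrix_zero_succ]
      simp [Fin.succ_ne_zero]

theorem isCoprime_continuants : ∀ (n : ℕ) (c : Fin (n + 1) → ℤ),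
    IsCoprime (continuants n c).1 (continuants n c).2
  | 0, _ => isCoprime_one_right
  | n + 1, c => by
    obtain ⟨u, v, h⟩ := isCoprime_continuants n (Fin.tail c)
    exact ⟨-v, u + v * c 0, by simp only [continuants]; linear_combination h⟩

theorem continuants_pos {n : ℕ} {c : Fin (n + 1) → ℤ}
    (h : ((chainMatrix c).map (Int.cast : ℤ → ℝ)).PosDef) : 0 < (continuants n c).1 := by
  have h1 := h.det_pos
  rw [← Int.cast_det, det_chainMatrix] at h1
  exact_mod_cast h1

theorem posDef_chainMatrix_tail {n : ℕ} {c : Fin (n + 2) → ℤ}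
    (h : ((chainMatrix c).map (Int.cast : ℤ → ℝ)).PosDef) :
    ((chainMatrix (Fin.tail c)).map (Int.cast : ℤ → ℝ)).PosDef := by
  rw [← chainMatrix_submatrix_succ]
  exact h.submatrix (Fin.succ_injective _)

/-- Positive definiteness passes to the tails and makes their numerators positive, so `contFrac`
never divides by zero. -/
theorem contFrac_eq_continuants : ∀ (n : ℕ) (c : Fin (n + 1) → ℤ),
    ((chainMatrix c).map (Int.cast : ℤ → ℝ)).PosDef →
      contFrac n c = ((continuants n c).1 : ℚ) / (continuants n c).2
  | 0, c, _ => by simp [contFrac, continuants]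
  | n + 1, c, h => by
    have h' := posDef_chainMatrix_tail h
    have h0 : ((continuants n (Fin.tail c)).1 : ℚ) ≠ 0 := by
      exact_mod_cast (continuants_pos h').ne'
    rw [contFrac, contFrac_eq_continuants n _ h', one_div_div, continuants]
    push_cast
    field_simp

theorem continuants_pos_snd : ∀ {n : ℕ} {c : Fin (n + 1) → ℤ},
    ((chainMatrix c).map (Int.cast : ℤ → ℝ)).PosDef → 0 < (continuants n c).2
  | 0, _, _ => one_pos
  | _ + 1, _, h => continuants_pos (posDef_chainMatrix_tail h)

theorem eq_of_isCoprime_div_eq {a b p q : ℤ} (ha : 0 < a) (hp : 0 < p) (hq : 0 < q)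
    (hab : IsCoprime a b) (hpq : IsCoprime p q) (h : (p : ℚ) / q = (a : ℚ) / b) : p = a := by
  -- For `b = 0` the right side would be `0` by the convention on division, while `p / q` is
  -- nonzero.
  have hb : (b : ℚ) ≠ 0 := by
    intro hb
    rw [hb, div_zero, div_eq_zero_iff] at h
    rcases h with h | h
    · exact hp.ne' (by exact_mod_cast h)
    · exact hq.ne' (by exact_mod_cast h)
  have hq' : (q : ℚ) ≠ 0 := by exact_mod_cast hq.ne'
  rw [div_eq_div_iff hq' hb] at h
  have h' : p * b = a * q := by exact_mod_cast h
  refine Int.dvd_antisymm hp.le ha.le ?_ ?_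
  · exact hpq.dvd_of_dvd_mul_right ⟨b, h'.symm⟩
  · exact hab.dvd_of_dvd_mul_right ⟨q, h'⟩

/-- Applied to a column of `M⁻¹` along a leg, with `x` the entry at the node, this compares the node
with the leaf. The tail of `y` solves the same system with source `y 0`, so everything is determined
from the leaf inwards. -/
theorem chainMatrix_kernel : ∀ (n : ℕ) (c : Fin (n + 1) → ℤ) (x : ℚ) (y : Fin (n + 1) → ℚ),
    (∀ j, ∑ k, (chainMatrix c j k : ℚ) * y k = if j = 0 then x else 0) →
      x = (continuants n c).1 * y (Fin.last n) ∧ y 0 = (continuants n c).2 * y (Fin.last n)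
  | 0, c, x, y, h => by
    have := h 0
    simp [chainMatrix_zero_zero] at this
    simp [continuants, this]
  | n + 1, c, x, y, h => by
    have h1 : ∀ j, ∑ k, (chainMatrix (Fin.tail c) j k : ℚ) * Fin.tail y k
        = if j = 0 then y 0 else 0 := by
      intro j
      have := h j.succ
      rw [Fin.sum_univ_succ, chainMatrix_succ_zero, if_neg (Fin.succ_ne_zero j)] at this
      simp only [chainMatrix_succ_succ] at this
      split_ifs at this ⊢ <;> push_cast at this <;> simp only [Fin.tail] <;> linarith
    obtain ⟨h2, h3⟩ := chainMatrix_kernel n _ _ _ h1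
    have h4 := h 0
    rw [Fin.sum_univ_succ, Fin.sum_univ_succ, Finset.sum_eq_zero, chainMatrix_zero_zero,
      chainMatrix_zero_succ, if_pos rfl, if_pos rfl] at h4
    · simp only [Fin.tail, Fin.succ_last] at h2 h3
      refine ⟨?_, h2⟩
      rw [h2, h3] at h4
      simp only [continuants]
      push_cast at h4 ⊢
      linear_combination -h4
    · intro k _
      rw [chainMatrix_zero_succ]
      simp [Fin.succ_ne_zero]

/-! ## Star-shaped graphs -/

section Star

variable {k : ℕ} {n : Fin k → ℕ}

theorem starGraph_adj_none_some (p : Σ i, Fin (n i + 1)) :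
    (starGraph n).Adj none (some p) ↔ p.2 = 0 := by
  simp [starGraph]

theorem starGraph_adj_some_some (p q : Σ i, Fin (n i + 1)) :
    (starGraph n).Adj (some p) (some q)
      ↔ p.1 = q.1 ∧ ((q.2 : ℕ) = p.2 + 1 ∨ (p.2 : ℕ) = q.2 + 1) := by
  simp only [starGraph, SimpleGraph.fromRel_adj, ne_eq, Option.some.injEq]
  constructor
  · rintro ⟨_, h | h⟩
    · exact ⟨h.1, .inl h.2⟩
    · exact ⟨h.1.symm, .inr h.2⟩
  · rintro ⟨h1, h2⟩
    refine ⟨?_, h2.imp (fun h => ⟨h1, h⟩) fun h => ⟨h1.symm, h⟩⟩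
    rintro rfl
    omega

theorem seifertPlumbing_matrix_none_some (b : ℤ) (c : (i : Fin k) → Fin (n i + 1) → ℤ)
    (p : Σ i, Fin (n i + 1)) :
    (seifertPlumbing b n c).matrix none (some p) = if p.2 = 0 then 1 else 0 := by
  simp [PlumbingGraph.matrix, seifertPlumbing, starGraph_adj_none_some]

theorem seifertPlumbing_matrix_some_none (b : ℤ) (c : (i : Fin k) → Fin (n i + 1) → ℤ)
    (p : Σ i, Fin (n i + 1)) :
    (seifertPlumbing b n c).matrix (some p) none = if p.2 = 0 then 1 else 0 := by
  rw [← seifertPlumbing_matrix_none_some b c p,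
    ← Matrix.transpose_apply (seifertPlumbing b n c).matrix (some p) none,
    PlumbingGraph.matrix_transpose]

theorem seifertPlumbing_matrix_same (b : ℤ) (c : (i : Fin k) → Fin (n i + 1) → ℤ) (i : Fin k)
    (j j' : Fin (n i + 1)) :
    (seifertPlumbing b n c).matrix (some ⟨i, j⟩) (some ⟨i, j'⟩) = -chainMatrix (c i) j j' := by
  simp only [PlumbingGraph.matrix, seifertPlumbing, Matrix.of_apply, starGraph_adj_some_some,
    chainMatrix, Option.some.injEq, Sigma.mk.injEq, heq_eq_eq, true_and]
  split_ifs <;> simp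

theorem seifertPlumbing_matrix_of_ne (b : ℤ) (c : (i : Fin k) → Fin (n i + 1) → ℤ)
    {p q : Σ i, Fin (n i + 1)} (h : p.1 ≠ q.1) :
    (seifertPlumbing b n c).matrix (some p) (some q) = 0 := by
  have : p ≠ q := fun h' => h (congrArg _ h')
  simp [PlumbingGraph.matrix, seifertPlumbing, starGraph_adj_some_some, h, this]

theorem posDef_chainMatrix_of_negDef {b : ℤ} {c : (i : Fin k) → Fin (n i + 1) → ℤ}
    (h : (seifertPlumbing b n c).NegDef) (i : Fin k) :
    ((chainMatrix (c i)).map (Int.cast : ℤ → ℝ)).PosDef := by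
  have h1 : ((chainMatrix (c i)).map (Int.cast : ℤ → ℝ))
      = (-((seifertPlumbing b n c).matrix.map (Int.cast : ℤ → ℝ))).submatrix
        (fun j => some ⟨i, j⟩) (fun j => some ⟨i, j⟩) := by
    ext j j'
    simp [seifertPlumbing_matrix_same]
  rw [h1]
  refine Matrix.PosDef.submatrix h fun j j' hj => ?_
  simpa using hj

/-- Replacing the row of the node by a unit vector disconnects the legs. With the node ordered last
the matrix is block triangular, and its diagonal blocks are the leg matrices and a `1`. -/
theorem seifertPlumbing_det_updateRow (b : ℤ) (c : (i : Fin k) → Fin (n i + 1) → ℤ) :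
    ((-(seifertPlumbing b n c).matrix).updateRow none (Pi.single none 1)).det
      = ∏ i, (continuants (n i) (c i)).1 := by
  set U := (-(seifertPlumbing b n c).matrix).updateRow none (Pi.single none 1) with hU
  have hsome : ∀ p w, U (some p) w = -(seifertPlumbing b n c).matrix (some p) w := by
    intro p w
    rw [hU, Matrix.updateRow_ne (by simp), Matrix.neg_apply]
  let f : StarVertex n → Fin (k + 1) := fun v => match v with
    | none => Fin.last k
    | some p => p.1.castSucc
  have htri : U.BlockTriangular f := by
    intro v w hvw
    rcases v with _ | p <;> rcases w with _ | q
    · exact (lt_irrefl _ hvw).elim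
    · simp [hU]
    · exact (not_lt_of_ge (Fin.le_last _) hvw).elim
    · rw [hsome, seifertPlumbing_matrix_of_ne, neg_zero]
      intro h
      simp [f, h] at hvw
  rw [htri.det_fintype, Fin.prod_univ_castSucc]
  have hlast : (U.toSquareBlock f (Fin.last k)).det = 1 := by
    have hu : ∀ v : {v // f v = Fin.last k}, v = ⟨none, rfl⟩ := by
      rintro ⟨_ | p, hp⟩
      · rfl
      · exact ((Fin.castSucc_lt_last p.1).ne hp).elim
    let : Unique {v // f v = Fin.last k} := ⟨⟨⟨none, rfl⟩⟩, hu⟩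
    rw [Matrix.det_unique, hu default]
    simp [Matrix.toSquareBlock, Matrix.toSquareBlockProp, hU]
  rw [hlast, mul_one]
  refine Finset.prod_congr rfl fun i _ => ?_
  have hbij : Function.Bijective (fun j : Fin (n i + 1) =>
      (⟨some ⟨i, j⟩, rfl⟩ : {v // f v = i.castSucc})) := by
    constructor
    · intro j j' h
      simpa using h
    · rintro ⟨_ | ⟨i', j⟩, hp⟩
      · exact ((Fin.castSucc_lt_last i).ne' hp).elim
      · obtain rfl : i' = i := Fin.castSucc_injective _ hp
        exact ⟨j, rfl⟩
  rw [← det_chainMatrix, ← Matrix.det_submatrix_equiv_self (Equiv.ofBijective _ hbij)]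
  congr 1
  ext j j'
  simp [Matrix.toSquareBlock, Matrix.toSquareBlockProp, hsome, seifertPlumbing_matrix_same]

end Star

/-! ### The order of `H₁` and the inverse of a plumbing matrix -/

theorem card_quotient_range_mulVecLin {V : Type*} [Fintype V] [DecidableEq V] (M : Matrix V V ℤ)
    (hM : M.det ≠ 0) : Nat.card ((V → ℤ) ⧸ LinearMap.range M.mulVecLin) = M.det.natAbs := by
  let e := LinearEquiv.ofInjective M.mulVecLin (Matrix.mulVec_injective_of_det_ne_zero hM)
  rw [← Submodule.natAbs_det_equiv _ e]
  have h : (LinearMap.range M.mulVecLin).subtype ∘ₗ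
      AddMonoidHom.toIntLinearMap (e : (V → ℤ) →+ LinearMap.range M.mulVecLin)
      = Matrix.toLin' M := by
    refine LinearMap.ext fun x => ?_
    rfl
  rw [h, LinearMap.det_toLin']

namespace PlumbingGraph

variable {V : Type*} [Fintype V] [DecidableEq V] {Γ : PlumbingGraph V}

theorem NegDef.orderH1_eq_det (h : Γ.NegDef) : (Γ.orderH1 : ℤ) = (-Γ.matrix).det := by
  have hpos : 0 < (-Γ.matrix).det := by
    have h1 := Matrix.PosDef.det_pos h
    have h2 : (-(Γ.matrix.map (Int.cast : ℤ → ℝ))) = (-Γ.matrix).map (Int.cast : ℤ → ℝ) := by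
      ext; simp
    rw [h2, ← Int.cast_det] at h1
    exact_mod_cast h1
  rw [orderH1, card_quotient_range_mulVecLin _ h.isUnit_det, ← Int.natAbs_of_nonneg hpos.le,
    Matrix.det_neg, Int.natAbs_mul, Int.natAbs_pow]
  simp

theorem NegDef.isUnit_det_map (h : Γ.NegDef) : IsUnit (Γ.matrix.map (Int.cast : ℤ → ℚ)).det := by
  rw [← Int.cast_det, isUnit_iff_ne_zero]
  exact_mod_cast h.isUnit_det

theorem invMatrix_symm (v w : V) : Γ.invMatrix v w = Γ.invMatrix w v := by
  rw [← Matrix.transpose_apply Γ.invMatrix, invMatrix, Matrix.transpose_nonsing_inv,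
    ← Matrix.transpose_map, matrix_transpose]

theorem NegDef.sum_matrix_mul_invMatrix (h : Γ.NegDef) (v w : V) :
    ∑ u, (Γ.matrix v u : ℚ) * Γ.invMatrix u w = if v = w then 1 else 0 := by
  have := congrFun (congrFun (Matrix.mul_nonsing_inv _ h.isUnit_det_map) v) w
  rwa [Matrix.mul_apply, Matrix.one_apply] at this

/-- A diagonal entry of `-|H| M⁻¹` is a principal minor of `-M`. -/
theorem NegDef.orderH1_mul_invMatrix_self (h : Γ.NegDef) (v : V) :
    -(Γ.orderH1 : ℚ) * Γ.invMatrix v v = ((-Γ.matrix).updateRow v (Pi.single v 1)).det := by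
  -- Since `adj(-M) = -|H| M⁻¹`, the claim reduces to the expression of a diagonal entry of the
  -- adjugate as a determinant with one row replaced.
  have h1 : (-Γ.matrix) * (-Γ.matrix).adjugate = (Γ.orderH1 : ℤ) • 1 := by
    rw [Matrix.mul_adjugate, h.orderH1_eq_det]
  have h2 : (Γ.matrix.map (Int.cast : ℤ → ℚ)) * (-Γ.matrix).adjugate.map (Int.cast : ℤ → ℚ)
      = -(Γ.orderH1 : ℚ) • 1 := by
    have := congrArg (fun N : Matrix V V ℤ => N.map (Int.castRingHom ℚ)) h1
    simp only [Matrix.map_mul] at this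
    ext i j
    have := congrFun (congrFun this i) j
    simp only [Matrix.mul_apply, Matrix.map_apply, Matrix.neg_apply, Matrix.smul_apply,
      map_neg, eq_intCast,
      neg_mul, Finset.sum_neg_distrib, Matrix.one_apply, smul_eq_mul] at this ⊢
    rw [← neg_eq_iff_eq_neg, this]
    push_cast
    split_ifs <;> simp
  have h3 : (-Γ.matrix).adjugate.map (Int.cast : ℤ → ℚ) = -(Γ.orderH1 : ℚ) • Γ.invMatrix := by
    rw [invMatrix, ← Matrix.mul_one (_ • _), Matrix.smul_mul, ← Matrix.mul_smul, ← h2,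
      ← Matrix.mul_assoc,
      Matrix.nonsing_inv_mul _ h.isUnit_det_map, Matrix.one_mul]
  have h4 := congrFun (congrFun h3 v) v
  rw [Matrix.map_apply, Matrix.adjugate_apply, Matrix.smul_apply, smul_eq_mul] at h4
  exact h4.symm

end PlumbingGraph

/-! ## The inverse of a star-shaped plumbing matrix -/

section StarInverse

variable {k : ℕ} {n : Fin k → ℕ} {b : ℤ} {c : (i : Fin k) → Fin (n i + 1) → ℤ}

theorem seifertPlumbing_orderH1_mul_invMatrix_none (h : (seifertPlumbing b n c).NegDef) :
    -((seifertPlumbing b n c).orderH1 : ℚ) * (seifertPlumbing b n c).invMatrix none none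
      = ∏ i, ((continuants (n i) (c i)).1 : ℚ) := by
  rw [h.orderH1_mul_invMatrix_self, seifertPlumbing_det_updateRow]
  push_cast
  rfl

/-- As `w` is off leg `i`, column `w` of `M M⁻¹ = 1` vanishes along that leg, and
`chainMatrix_kernel` applies with the node as source. -/
theorem seifertPlumbing_invMatrix_none (h : (seifertPlumbing b n c).NegDef) (i : Fin k)
    (w : StarVertex n) (hw : ∀ j, w ≠ some ⟨i, j⟩) :
    (seifertPlumbing b n c).invMatrix none w
      = (continuants (n i) (c i)).1 * (seifertPlumbing b n c).invMatrix (starLeaf n i) w := by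
  refine (chainMatrix_kernel (n i) (c i) _
    (fun j => (seifertPlumbing b n c).invMatrix (some ⟨i, j⟩) w) fun j => ?_).1
  have h1 := h.sum_matrix_mul_invMatrix (some ⟨i, j⟩) w
  rw [if_neg (hw j).symm, Fintype.sum_option, Fintype.sum_sigma, Finset.sum_eq_single i,
    seifertPlumbing_matrix_some_none] at h1
  · simp only [seifertPlumbing_matrix_same] at h1
    push_cast at h1
    simp only [neg_mul, Finset.sum_neg_distrib, ite_mul, one_mul, zero_mul] at h1
    linarith
  · intro i' _ hi
    refine Finset.sum_eq_zero fun j' _ => ?_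
    rw [seifertPlumbing_matrix_of_ne b c hi.symm, Int.cast_zero, zero_mul]
  · simp

theorem seifertPlumbing_orderH1_mul_invMatrix_leaf (h : (seifertPlumbing b n c).NegDef)
    (i : Fin k) :
    -((seifertPlumbing b n c).orderH1 : ℚ)
        * (seifertPlumbing b n c).invMatrix none (starLeaf n i)
      = (∏ i, ((continuants (n i) (c i)).1 : ℚ)) / (continuants (n i) (c i)).1 := by
  have h0 : ((continuants (n i) (c i)).1 : ℚ) ≠ 0 := by
    exact_mod_cast (continuants_pos (posDef_chainMatrix_of_negDef h i)).ne'
  rw [← seifertPlumbing_orderH1_mul_invMatrix_none h, eq_div_iff h0,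
    seifertPlumbing_invMatrix_none h i none (by simp), PlumbingGraph.invMatrix_symm none]
  ring

/-- Leaf `j` is off leg `i`, so its column gives a further division by the continuant of leg `i`.
This fails for `i = j`, which is why the diagonal leaf entries remain in `seifertDelta`. -/
theorem seifertPlumbing_orderH1_mul_invMatrix_leaf_leaf (h : (seifertPlumbing b n c).NegDef)
    {i j : Fin k} (hij : i ≠ j) :
    -((seifertPlumbing b n c).orderH1 : ℚ)
        * (seifertPlumbing b n c).invMatrix (starLeaf n i) (starLeaf n j)
      = (∏ i, ((continuants (n i) (c i)).1 : ℚ))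
        / ((continuants (n i) (c i)).1 * (continuants (n j) (c j)).1) := by
  have h0 : ((continuants (n i) (c i)).1 : ℚ) ≠ 0 := by
    exact_mod_cast (continuants_pos (posDef_chainMatrix_of_negDef h i)).ne'
  rw [mul_comm ((continuants (n i) (c i)).1 : ℚ), ← div_div,
    ← seifertPlumbing_orderH1_mul_invMatrix_leaf h j, eq_div_iff h0,
    seifertPlumbing_invMatrix_none h i (starLeaf n j)]
  · ring
  · intro j' hj'
    simp only [starLeaf, Option.some.injEq, Sigma.mk.injEq] at hj'
    exact hij hj'.1.symm

end StarInverse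

/-! ## Degrees in a star-shaped graph -/

open Classical in
theorem PlumbingGraph.deg_eq_sum {V : Type*} [Fintype V] (Γ : PlumbingGraph V) (v : V) :
    Γ.deg v = ∑ w, if Γ.graph.Adj v w then 1 else 0 := by
  rw [Finset.sum_boole, ← SimpleGraph.neighborFinset_eq_filter, PlumbingGraph.deg]
  simp

theorem sum_chain_neighbors {n : ℕ} (j : Fin (n + 1)) :
    (∑ k : Fin (n + 1), if (k : ℕ) = j + 1 ∨ (j : ℕ) = k + 1 then 1 else 0)
      = (if j = Fin.last n then 0 else 1) + if j = 0 then 0 else 1 := by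
  have h1 : ∀ k : Fin (n + 1), (if (k : ℕ) = j + 1 ∨ (j : ℕ) = k + 1 then 1 else 0)
      = (if (k : ℕ) = j + 1 then 1 else 0) + if (j : ℕ) = k + 1 then 1 else 0 := by
    intro k
    split_ifs <;> omega
  simp only [h1, Finset.sum_add_distrib]
  congr 1
  · rw [Fin.sum_univ_eq_sum_range (fun m => if m = (j : ℕ) + 1 then 1 else 0), Finset.sum_ite_eq']
    simp only [Finset.mem_range, Fin.ext_iff, Fin.val_last]
    split_ifs <;> omega
  · rw [Fin.sum_univ_eq_sum_range (fun m => if (j : ℕ) = m + 1 then 1 else 0)]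
    obtain ⟨j, hj⟩ := j
    cases j with
    | zero => simp
    | succ j =>
      simp only [add_left_inj, Finset.sum_ite_eq, Finset.mem_range, Fin.ext_iff, Fin.val_zero]
      split_ifs <;> omega

section StarDegree

variable {k : ℕ} {n : Fin k → ℕ} (b : ℤ) (c : (i : Fin k) → Fin (n i + 1) → ℤ)

theorem seifertPlumbing_deg_none : (seifertPlumbing b n c).deg none = k := by
  classical
  rw [PlumbingGraph.deg_eq_sum, Fintype.sum_option, Fintype.sum_sigma]
  simp only [seifertPlumbing, starGraph_adj_none_some, SimpleGraph.irrefl, if_false, zero_add]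
  rw [Finset.sum_congr rfl fun i _ => Finset.sum_eq_single 0 (by simp +contextual) (by simp)]
  simp

/-- The first vertex of a leg has the node in place of a predecessor, so only the end of the leg
misses a neighbour. -/
theorem seifertPlumbing_deg_some (i : Fin k) (j : Fin (n i + 1)) :
    (seifertPlumbing b n c).deg (some ⟨i, j⟩) = if j = Fin.last (n i) then 1 else 2 := by
  classical
  rw [PlumbingGraph.deg_eq_sum, Fintype.sum_option, Fintype.sum_sigma, Finset.sum_eq_single i]
  · simp only [seifertPlumbing, (starGraph n).adj_comm _ none, starGraph_adj_none_some,
      starGraph_adj_some_some, true_and]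
    have := sum_chain_neighbors j
    rw [Finset.sum_congr rfl fun _ _ => if_congr Iff.rfl rfl rfl, this]
    split_ifs <;> simp_all
  · intro i' _ hi
    simp [seifertPlumbing, starGraph_adj_some_some, hi.symm]
  · simp

theorem seifertPlumbing_deg_leaf (i : Fin k) :
    (seifertPlumbing b n c).deg (starLeaf n i) = 1 := by
  rw [starLeaf, seifertPlumbing_deg_some, if_pos rfl]

end StarDegree

/-! ### Reindexing the total series by covectors -/

namespace PlumbingGraph

theorem theta_add_form {V : Type*} [Fintype V] (Γ : PlumbingGraph V) (k : Γ.CharVec) (x : V → ℤ) :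
    Γ.theta k.1 + Γ.form x 1 = (∑ v, (2 • Γ.matrix.mulVec x + Γ.shift k.1) v) / 2 := by
  have h1 : ∑ v, (2 • Γ.matrix.mulVec x + Γ.shift k.1) v
      = k.1 ⬝ᵥ 1 - Γ.form 1 1 + 2 * Γ.form x 1 := by
    rw [form_comm Γ x 1]
    simp only [form, shift, dotProduct, Pi.add_apply, Pi.sub_apply, Finset.sum_add_distrib,
      Finset.sum_sub_distrib, Pi.one_apply, one_mul, mul_one, two_nsmul]
    ring
  rw [h1, Int.add_mul_ediv_left _ _ two_ne_zero, theta]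

section Reindex

variable {V : Type*} [Fintype V] [DecidableEq V] {Γ : PlumbingGraph V}

/-- Because `Mu = m + δ`, characteristic vectors become, after subtraction of `Mu`, the covectors
with the parity of the degrees. -/
theorem mulVec_one_apply (Γ : PlumbingGraph V) (v : V) :
    Γ.matrix.mulVec 1 v = Γ.weight v + Γ.deg v := by
  classical
  simp only [Matrix.mulVec, dotProduct, matrix, Matrix.of_apply, Pi.one_apply, mul_one]
  rw [deg_eq_sum, ← Finset.add_sum_erase _ _ (Finset.mem_univ v), if_pos rfl,
    ← Finset.add_sum_erase _ (fun w => if Γ.graph.Adj v w then 1 else 0) (Finset.mem_univ v),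
    if_neg (Γ.graph.irrefl), zero_add]
  push_cast
  congr 1
  refine Finset.sum_congr rfl fun w hw => ?_
  rw [if_neg (Finset.ne_of_mem_erase hw).symm]

/-- The exponent of `q` attached to the covector `l = 2 M x + k - M u`. -/
noncomputable def covecExp (Γ : PlumbingGraph V) (l : V → ℤ) : ℚ :=
  -(3 * Fintype.card V + ∑ v, (Γ.weight v : ℚ)) / 4 - Γ.invSq l / 4

/-- The covectors with the parity of the degrees. -/
def parityCovecs (Γ : PlumbingGraph V) : Set (V → ℤ) := {l | ∀ v, l v ≡ Γ.deg v [ZMOD 2]}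

/-- The covector `2 M x + k - M u`, for the chosen representative `k` of a spin^c structure. -/
noncomputable def covec (Γ : PlumbingGraph V) (p : Γ.SpinC × (V → ℤ)) : V → ℤ :=
  2 • Γ.matrix.mulVec p.2 + Γ.shift (Quotient.out p.1 : Γ.CharVec).1

/-- Conversely, for `l` of the right parity `l + Mu` is characteristic, and it differs from the
chosen representative of its class by an element of `2Mℤ^s`. -/
theorem range_covec (Γ : PlumbingGraph V) : Set.range Γ.covec = Γ.parityCovecs := by
  ext l
  constructor
  · rintro ⟨p, rfl⟩ v
    have h1 := (Quotient.out p.1 : Γ.CharVec).2 v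
    have h2 : Γ.covec p v = 2 * Γ.matrix.mulVec p.2 v + ((Quotient.out p.1 : Γ.CharVec).1 v
        - (Γ.weight v + Γ.deg v)) := by
      simp [covec, shift, mulVec_one_apply]
    rw [h2]
    unfold Int.ModEq at h1 ⊢
    omega
  · intro hl
    have hk : ∀ v, (l + Γ.matrix.mulVec 1) v ≡ Γ.weight v [ZMOD 2] := by
      intro v
      have h1 := hl v
      rw [Pi.add_apply, mulVec_one_apply]
      unfold Int.ModEq at h1 ⊢
      omega
    obtain ⟨y, hy⟩ := Quotient.exact
      (Quotient.out_eq (Quotient.mk Γ.charSetoid ⟨l + Γ.matrix.mulVec 1, hk⟩))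
    refine ⟨(Quotient.mk Γ.charSetoid ⟨l + Γ.matrix.mulVec 1, hk⟩, y), ?_⟩
    rw [covec, shift]
    simp only at hy
    rw [eq_comm, ← sub_eq_iff_eq_add] at hy
    rw [← add_sub_assoc, add_comm (2 • _), eq_comm, ← add_right_cancel_iff, sub_add_cancel]
    rw [sub_eq_iff_eq_add] at hy
    exact hy.symm

theorem NegDef.covec_injective (h : Γ.NegDef) : Function.Injective Γ.covec := by
  rintro ⟨κ, x⟩ ⟨κ', x'⟩ hp
  have hp' : 2 • Γ.matrix.mulVec x + (Quotient.out κ : Γ.CharVec).1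
      = 2 • Γ.matrix.mulVec x' + (Quotient.out κ' : Γ.CharVec).1 := by
    simp only [covec, shift] at hp
    rwa [← add_sub_assoc, ← add_sub_assoc, sub_left_inj] at hp
  have hκ : κ = κ' := by
    rw [← Quotient.out_eq κ, ← Quotient.out_eq κ']
    refine Quotient.sound ⟨x - x', ?_⟩
    rw [Matrix.mulVec_sub, smul_sub, ← add_sub_assoc, add_comm _ (2 • _), hp']
    abel
  subst hκ
  have hx : Γ.matrix.mulVec x = Γ.matrix.mulVec x' := by
    rw [add_left_inj] at hp'
    exact smul_right_injective _ (two_ne_zero) hp'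
  rw [Matrix.mulVec_injective_of_det_ne_zero h.isUnit_det hx]

theorem NegDef.qExp_out (h : Γ.NegDef) (p : Γ.SpinC × (V → ℤ)) :
    Γ.qExp (Quotient.out p.1 : Γ.CharVec).1 p.2 = Γ.covecExp (Γ.covec p) :=
  qExp_eq h _ _

theorem NegDef.finite_covecExp_comp (h : Γ.NegDef) (e : ℚ) :
    {p | Γ.covecExp (Γ.covec p) = e}.Finite := by
  have := finite_spinC h
  refine (Set.finite_iUnion fun κ : Γ.SpinC =>
    (finite_qExp_le h (Quotient.out κ : Γ.CharVec).1 e).image (Prod.mk κ)).subset ?_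
  rintro ⟨κ, x⟩ hp
  refine Set.mem_iUnion.mpr ⟨κ, x, ?_, rfl⟩
  exact ((h.qExp_out (κ, x)).trans hp).le

/-- Finitely many covectors contribute to a given exponent of `q`. -/
theorem NegDef.finite_covecExp (h : Γ.NegDef) (e : ℚ) :
    (Γ.parityCovecs ∩ {l | Γ.covecExp l = e}).Finite := by
  refine ((h.finite_covecExp_comp e).image Γ.covec).subset ?_
  rintro l ⟨hl, he⟩
  rw [← range_covec] at hl
  obtain ⟨p, rfl⟩ := hl
  exact ⟨p, he, rfl⟩

/-- The total series as a sum over the covectors with the parity of the degrees. -/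
theorem totalSeries_apply {R : Type*} [CommRing R] (h : Γ.NegDef) (W : ℕ → ℤ → R) (e : ℚ) :
    Γ.totalSeries h W e = ∑ᶠ l ∈ Γ.parityCovecs ∩ {l | Γ.covecExp l = e},
      C (∏ v, W (Γ.deg v) (l v)) * T ((∑ v, l v) / 2) := by
  have hfin := finite_spinC h
  have := Fintype.ofFinite Γ.SpinC
  let F : (V → ℤ) → R[T;T⁻¹] := fun l => ∑ᶠ (_ : Γ.covecExp l = e),
    C (∏ v, W (Γ.deg v) (l v)) * T ((∑ v, l v) / 2)
  have h1 : Γ.totalSeries h W e = ∑ᶠ κ, ∑ᶠ x, F (Γ.covec (κ, x)) := by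
    rw [totalSeries, finsum_eq_sum_of_fintype, finsum_eq_sum_of_fintype, Finset.sum_apply]
    refine Finset.sum_congr rfl fun κ _ => ?_
    have h2 : Γ.series h W κ = Γ.seriesRep W (Quotient.out κ : Γ.CharVec).1 := by
      conv_lhs => rw [← Quotient.out_eq κ]
      rfl
    rw [h2, seriesRep]
    refine finsum_congr fun x => ?_
    simp only [F, h.qExp_out (κ, x), theta_add_form]
    rfl
  -- `finsum` is `0` on an infinite support, so finiteness is needed to merge the double sum.
  have h3 : (Function.support fun p => F (Γ.covec p)).Finite := by
    refine (h.finite_covecExp_comp e).subset fun p hp => ?_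
    by_contra hne
    have hne' : Γ.covecExp (Γ.covec p) ≠ e := hne
    exact hp (by simp [F, hne'])
  rw [h1, ← finsum_curry _ h3, ← finsum_mem_range h.covec_injective, range_covec]
  refine finsum_congr fun l => ?_
  by_cases hl : l ∈ Γ.parityCovecs <;> by_cases he : Γ.covecExp l = e <;> simp [F, hl, he]

end Reindex

end PlumbingGraph

/-! ## Admissible families on vectors with the parity of the degrees -/

section Admissible

variable {R : Type*} [CommRing R] {W : ℕ → ℤ → R}

theorem IsAdmissible.two (hW : IsAdmissible W) (r : ℤ) : W 2 r = if r = 0 then 1 else 0 := by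
  split_ifs with h
  · rw [h, hW.two_zero]
  · exact hW.two_ne_zero r h

theorem IsAdmissible.one (hW : IsAdmissible W) (r : ℤ) :
    W 1 r = (if r = -1 then 1 else 0) - if r = 1 then 1 else 0 := by
  rw [← hW.step 2 (by norm_num) r, hW.two, hW.two]
  simp only [sub_eq_zero, add_eq_zero_iff_eq_neg]

theorem IsAdmissible.one_unit (hW : IsAdmissible W) (ε : ℤˣ) : W 1 ε = -((ε : ℤ) : R) := by
  rw [hW.one]
  rcases Int.units_eq_one_or ε with rfl | rfl <;> simp

/-- Since `W 2` is a delta function, `W 3` is constant along odd integers except for a jump by `1`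
from `-1` to `1`. -/
theorem IsAdmissible.three_odd (hW : IsAdmissible W) {r : ℤ} (hr : Odd r) :
    W 3 r = if 0 < r then W 3 1 else W 3 1 - 1 := by
  have hstep : ∀ m : ℤ, W 3 (2 * m + 1) - W 3 (2 * m - 1) = if m = 0 then 1 else 0 := by
    intro m
    rw [hW.step 3 (by norm_num), hW.two]
    simp
  obtain ⟨m, rfl⟩ := hr
  induction m with
  | zero => simp
  | succ i ih =>
    have := hstep (i + 1)
    rw [if_neg (by omega)] at this
    rw [if_pos (by omega)] at ih ⊢
    rw [← ih, ← sub_eq_zero, ← this]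
    ring_nf
  | pred i ih =>
    have := hstep (-i)
    rw [if_neg (by omega), show 2 * (-(i : ℤ) - 1) + 1 = 2 * -i - 1 by ring]
    by_cases hi : i = 0
    · subst hi
      simp only [Int.natCast_zero, neg_zero, mul_zero, zero_add, if_true] at this ⊢
      linear_combination -this
    · rw [if_neg (by omega)] at this ih
      linear_combination ih - this

end Admissible

/-! ## The total series of a star-shaped graph -/

section StarCovec

variable {k : ℕ}

/-- The covector with value `r` at the node, `± 1` at the leaves and `0` elsewhere. -/
def starCovec (n : Fin k → ℕ) (p : ℤ × (Fin k → ℤˣ)) : StarVertex n → ℤ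
  | none => p.1
  | some q => if q.2 = Fin.last (n q.1) then p.2 q.1 else 0

theorem starCovec_leaf (n : Fin k → ℕ) (p : ℤ × (Fin k → ℤˣ)) (i : Fin k) :
    starCovec n p (starLeaf n i) = p.2 i := if_pos rfl

theorem starCovec_injective (n : Fin k → ℕ) : Function.Injective (starCovec n) := by
  intro p p' h
  refine Prod.ext (congrFun h none) (funext fun i => Units.ext ?_)
  rw [← starCovec_leaf n p, ← starCovec_leaf n p', h]

theorem sum_starCovec_mul (n : Fin k → ℕ) (p : ℤ × (Fin k → ℤˣ)) (f : StarVertex n → ℚ) :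
    ∑ v, (starCovec n p v : ℚ) * f v
      = p.1 * f none + ∑ i, ((p.2 i : ℤ) : ℚ) * f (starLeaf n i) := by
  rw [Fintype.sum_option, Fintype.sum_sigma]
  congr 1
  refine Finset.sum_congr rfl fun i _ => ?_
  rw [Finset.sum_eq_single (Fin.last (n i))]
  · rw [← starCovec_leaf n p i]
    rfl
  · intro j _ hj
    simp [starCovec, hj]
  · simp

theorem sum_starCovec (n : Fin k → ℕ) (p : ℤ × (Fin k → ℤˣ)) :
    ∑ v, starCovec n p v = p.1 + ∑ i, (p.2 i : ℤ) := by
  have := sum_starCovec_mul n p fun _ => 1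
  simp only [mul_one] at this
  exact_mod_cast this

/-- The exponent of `z` attached to `starCovec n (r, ε)`. -/
def starExp (a : Fin k → ℤ) (p : ℤ × (Fin k → ℤˣ)) : ℤ :=
  fiberProd a * p.1 + ∑ i, (p.2 i : ℤ) * fiberProdOther a i

theorem starExp_cast {a : Fin k → ℤ} (ha : ∀ i, 0 < a i) (p : ℤ × (Fin k → ℤˣ)) :
    (starExp a p : ℚ) = fiberProd a * (p.1 + ∑ i, ((p.2 i : ℤ) : ℚ) / a i) := by
  rw [starExp, mul_add, Finset.mul_sum]
  push_cast
  congr 1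
  refine Finset.sum_congr rfl fun i _ => ?_
  have h0 : (a i : ℚ) ≠ 0 := by exact_mod_cast (ha i).ne'
  have h1 : fiberProd a = a i * fiberProdOther a i :=
    (Finset.mul_prod_erase _ _ (Finset.mem_univ i)).symm
  rw [h1]
  push_cast
  field_simp

theorem fiberProd_pos {a : Fin k → ℤ} (ha : ∀ i, 0 < a i) : 0 < fiberProd a :=
  Finset.prod_pos fun i _ => ha i

/-- The form is `A` times the square of the linear form `(1, α)` plus the diagonal `d` on the leaf
coordinates, which contributes a constant because `ε i ^ 2 = 1`. -/
theorem quadratic_expansion {A N₀₀ : ℚ} (r : ℚ) {N₀ ε α d : Fin k → ℚ} {N : Fin k → Fin k → ℚ}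
    (hε : ∀ i, ε i * ε i = 1) (h₀₀ : N₀₀ = A) (h₀ : ∀ i, N₀ i = A * α i)
    (h : ∀ i j, N i j = A * (α i * α j) + if i = j then d i else 0) :
    r * (r * N₀₀ + ∑ i, ε i * N₀ i) + ∑ i, ε i * (r * N₀ i + ∑ j, ε j * N i j)
      = A * (r + ∑ i, ε i * α i) ^ 2 + ∑ i, d i := by
  have h1 : ∑ i, ε i * N₀ i = A * ∑ i, ε i * α i := by
    rw [Finset.mul_sum]
    exact Finset.sum_congr rfl fun i _ => by rw [h₀, mul_left_comm]
  have h2 : ∀ i, ε i * (r * N₀ i + ∑ j, ε j * N i j)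
      = ε i * α i * (r * A + A * ∑ j, ε j * α j) + d i := by
    intro i
    have h3 : ∑ j, ε j * N i j = A * α i * ∑ j, ε j * α j + ε i * d i := by
      simp only [h, mul_add, Finset.sum_add_distrib, mul_ite, mul_zero, Finset.sum_ite_eq,
        Finset.mem_univ, if_true, Finset.mul_sum]
      exact congrArg (· + _) (Finset.sum_congr rfl fun j _ => by ring)
    rw [h3, h₀]
    linear_combination d i * hε i
  rw [h1, h₀₀, Finset.sum_congr rfl fun i _ => h2 i, Finset.sum_add_distrib, ← Finset.sum_mul]
  ring

variable {b : ℤ} {a : Fin k → ℤ} {n : Fin k → ℕ} {c : (i : Fin k) → Fin (n i + 1) → ℤ}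

theorem orderH1_mul_invSq_starCovec (hneg : (seifertPlumbing b n c).NegDef)
    (hca : ∀ i, (continuants (n i) (c i)).1 = a i) (p : ℤ × (Fin k → ℤˣ)) :
    -((seifertPlumbing b n c).orderH1 : ℚ) * (seifertPlumbing b n c).invSq (starCovec n p)
      = fiberProd a * (p.1 + ∑ i, ((p.2 i : ℤ) : ℚ) / a i) ^ 2
        + ∑ i, (-((seifertPlumbing b n c).orderH1 : ℚ)
            * (seifertPlumbing b n c).invMatrix (starLeaf n i) (starLeaf n i)
          - (fiberProd a : ℚ) / (a i : ℚ) ^ 2) := by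
  set Γ := seifertPlumbing b n c
  set h : ℚ := (Γ.orderH1 : ℚ)
  have hA : ∏ i, ((continuants (n i) (c i)).1 : ℚ) = fiberProd a := by
    simp [fiberProd, hca]
  have h00 : -h * Γ.invMatrix none none = fiberProd a := by
    rw [seifertPlumbing_orderH1_mul_invMatrix_none hneg, hA]
  have h0 : ∀ i, -h * Γ.invMatrix none (starLeaf n i) = fiberProd a / a i := by
    intro i
    rw [seifertPlumbing_orderH1_mul_invMatrix_leaf hneg, hA, hca]
  -- The diagonal leaf entries are split into the rank one part and a correction, which is the
  -- summand of `seifertDelta`.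
  have h1 : ∀ i j, -h * Γ.invMatrix (starLeaf n i) (starLeaf n j) = fiberProd a / (a i * a j)
      + if i = j then -h * Γ.invMatrix (starLeaf n i) (starLeaf n i) - fiberProd a / (a i) ^ 2
        else 0 := by
    intro i j
    split_ifs with hij
    · subst hij
      ring
    · rw [seifertPlumbing_orderH1_mul_invMatrix_leaf_leaf hneg hij, hA, hca, hca, add_zero]
  have hsq : ∀ i, ((p.2 i : ℤ) : ℚ) * ((p.2 i : ℤ) : ℚ) = 1 := by
    intro i
    rcases Int.units_eq_one_or (p.2 i) with h | h <;> simp [h]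
  have hrow : ∀ v, Γ.invMatrix.mulVec (fun v => (starCovec n p v : ℚ)) v
      = p.1 * Γ.invMatrix v none + ∑ i, ((p.2 i : ℤ) : ℚ) * Γ.invMatrix v (starLeaf n i) := by
    intro v
    rw [← sum_starCovec_mul, Matrix.mulVec, dotProduct]
    exact Finset.sum_congr rfl fun _ _ => mul_comm _ _
  rw [PlumbingGraph.invSq, dotProduct, sum_starCovec_mul]
  simp only [hrow]
  have key := quadratic_expansion (p.1 : ℚ) hsq (α := fun i => (a i : ℚ)⁻¹) h00
    (fun i => (h0 i).trans (div_eq_mul_inv _ _))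
    (fun i j => (h1 i j).trans (by rw [div_eq_mul_inv, mul_inv]))
  simp only [mul_left_comm _ (-h), ← Finset.mul_sum, ← mul_add, ← div_eq_mul_inv] at key
  rw [← key]
  simp only [PlumbingGraph.invMatrix_symm _ none]

theorem orderH1_mul_covecExp_starCovec (hneg : (seifertPlumbing b n c).NegDef)
    (ha : ∀ i, 0 < a i) (hca : ∀ i, (continuants (n i) (c i)).1 = a i) (p : ℤ × (Fin k → ℤˣ)) :
    (seifertPlumbing b n c).orderH1 * (seifertPlumbing b n c).covecExp (starCovec n p)
      = seifertDelta b a n c + (starExp a p : ℚ) ^ 2 / (4 * fiberProd a) := by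
  have h1 := orderH1_mul_invSq_starCovec hneg hca p
  have hA : (fiberProd a : ℚ) ≠ 0 := by exact_mod_cast (fiberProd_pos ha).ne'
  have h2 : (starExp a p : ℚ) ^ 2 / (4 * fiberProd a)
      = fiberProd a * (p.1 + ∑ i, ((p.2 i : ℤ) : ℚ) / a i) ^ 2 / 4 := by
    rw [starExp_cast ha]
    field_simp
  rw [h2, PlumbingGraph.covecExp]
  simp only [seifertDelta]
  linear_combination h1 / 4

theorem PlumbingGraph.NegDef.orderH1_pos {V : Type*} [Fintype V] {Γ : PlumbingGraph V}
    (h : Γ.NegDef) : 0 < Γ.orderH1 := by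
  classical
  rw [orderH1, card_quotient_range_mulVecLin _ h.isUnit_det]
  exact Int.natAbs_pos.mpr h.isUnit_det

theorem covecExp_starCovec_eq_iff (hneg : (seifertPlumbing b n c).NegDef)
    (ha : ∀ i, 0 < a i) (hca : ∀ i, (continuants (n i) (c i)).1 = a i) (p : ℤ × (Fin k → ℤˣ))
    (e : ℚ) :
    (seifertPlumbing b n c).covecExp (starCovec n p) = e / (seifertPlumbing b n c).orderH1
      ↔ (starExp a p : ℚ) ^ 2 / (4 * fiberProd a) = e - seifertDelta b a n c := by
  have h0 : ((seifertPlumbing b n c).orderH1 : ℚ) ≠ 0 := by exact_mod_cast hneg.orderH1_pos.ne'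
  rw [eq_div_iff h0, mul_comm, orderH1_mul_covecExp_starCovec hneg ha hca, eq_sub_iff_add_eq']

theorem prod_starCovec {R : Type*} [CommRing R] {W : ℕ → ℤ → R} (hW : IsAdmissible W)
    (p : ℤ × (Fin k → ℤˣ)) :
    ∏ v, W ((seifertPlumbing b n c).deg v) (starCovec n p v)
      = W k p.1 * ∏ i, -((p.2 i : ℤ) : R) := by
  rw [Fintype.prod_option, Fintype.prod_sigma, seifertPlumbing_deg_none]
  congr 1
  refine Finset.prod_congr rfl fun i _ => ?_
  rw [Finset.prod_eq_single (Fin.last (n i)), seifertPlumbing_deg_some, if_pos rfl,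
    ← hW.one_unit, ← starCovec_leaf n p i]
  · rfl
  · intro j _ hj
    rw [seifertPlumbing_deg_some, if_neg hj]
    simp [starCovec, hj, hW.two_zero]
  · simp

theorem exists_starCovec_of_prod_ne_zero {R : Type*} [CommRing R] {W : ℕ → ℤ → R}
    (hW : IsAdmissible W) {l : StarVertex n → ℤ}
    (hl : ∏ v, W ((seifertPlumbing b n c).deg v) (l v) ≠ 0) : ∃ p, l = starCovec n p := by
  have hv : ∀ v, W ((seifertPlumbing b n c).deg v) (l v) ≠ 0 := fun v h =>
    hl (Finset.prod_eq_zero (Finset.mem_univ v) h)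
  have hleaf : ∀ i, ∃ ε : ℤˣ, l (starLeaf n i) = ε := by
    intro i
    have := hv (starLeaf n i)
    rw [seifertPlumbing_deg_leaf, hW.one] at this
    by_cases h1 : l (starLeaf n i) = -1
    · exact ⟨-1, by simpa using h1⟩
    · by_cases h2 : l (starLeaf n i) = 1
      · exact ⟨1, by simpa using h2⟩
      · simp [h1, h2] at this
  choose ε hε using hleaf
  refine ⟨(l none, ε), funext fun v => ?_⟩
  rcases v with _ | ⟨i, j⟩
  · rfl
  · by_cases hj : j = Fin.last (n i)
    · subst hj
      exact (hε i).trans (starCovec_leaf n (l none, ε) i).symm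
    · have := hv (some ⟨i, j⟩)
      rw [seifertPlumbing_deg_some, if_neg hj, hW.two] at this
      have h0 : l (some ⟨i, j⟩) = 0 := by
        by_contra h
        simp [h] at this
      simp [starCovec, hj, h0]

theorem starCovec_mem_parityCovecs (p : ℤ × (Fin k → ℤˣ)) :
    starCovec n p ∈ (seifertPlumbing b n c).parityCovecs ↔ p.1 ≡ k [ZMOD 2] := by
  constructor
  · intro h
    have := h none
    rwa [seifertPlumbing_deg_none] at this
  · rintro h (_ | ⟨i, j⟩)
    · rw [seifertPlumbing_deg_none]
      exact h
    · rw [seifertPlumbing_deg_some]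
      by_cases hj : j = Fin.last (n i)
      · rcases Int.units_eq_one_or (p.2 i) with h' | h' <;> simp [starCovec, hj, h'] ; rfl
      · simp only [starCovec, hj, if_false]
        rfl

end StarCovec

/-! ### Comparison of the two sides -/

theorem tSquare_C_mul_T {R : Type*} [CommRing R] (r : R) (m : ℤ) :
    tSquare (C r * T m) = C r * T (2 * m) := by
  rw [← single_eq_C_mul_T, ← single_eq_C_mul_T]
  exact AddMonoidAlgebra.mapDomain_single

section Main

variable {R : Type*} [CommRing R]

/-- The coefficient of `z ^ (-starExp a (r, ε))`, a Laurent polynomial in `t`, contributed by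
`(r, ε)` to both sides of the theorem. -/
noncomputable def starTerm {k : ℕ} (y : R) (p : ℤ × (Fin k → ℤˣ)) : R[T;T⁻¹] :=
  C ((if 0 < p.1 then y else y - 1) * ∏ i, -((p.2 i : ℤ) : R)) * T (p.1 + ∑ i, (p.2 i : ℤ))

theorem finite_sq_div_eq (A : ℤ) (hA : 0 < A) (x : ℚ) :
    {m : ℤ | (m : ℚ) ^ 2 / (4 * A) = x}.Finite := by
  have hA' : (4 * A : ℚ) ≠ 0 := by
    have : (A : ℚ) ≠ 0 := by exact_mod_cast hA.ne'
    positivity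
  rcases Set.eq_empty_or_nonempty {m : ℤ | (m : ℚ) ^ 2 / (4 * A) = x} with h | ⟨m₀, h₀⟩
  · rw [h]
    exact Set.finite_empty
  · refine (Set.toFinite {m₀, -m₀}).subset fun m hm => ?_
    have h1 : (m : ℚ) ^ 2 / (4 * A) = (m₀ : ℚ) ^ 2 / (4 * A) := Eq.trans hm (Eq.symm h₀)
    rw [div_left_inj' hA'] at h1
    have h2 : m ^ 2 = m₀ ^ 2 := by exact_mod_cast h1
    exact sq_eq_sq_iff_eq_or_eq_neg.mp h2

theorem totalSeries_subst_apply {W : ℕ → ℤ → R} (hW : IsAdmissible W) {b : ℤ} {a : Fin 3 → ℤ}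
    {n : Fin 3 → ℕ} {c : (i : Fin 3) → Fin (n i + 1) → ℤ} (ha : ∀ i, 0 < a i)
    (hca : ∀ i, (continuants (n i) (c i)).1 = a i) (hneg : (seifertPlumbing b n c).NegDef)
    (e : ℚ) :
    ((seifertPlumbing b n c).totalSeries hneg W).subst (seifertPlumbing b n c).orderH1 e
      = ∑ᶠ p ∈ {p : ℤ × (Fin 3 → ℤˣ) | Odd p.1 ∧
          (starExp a p : ℚ) ^ 2 / (4 * fiberProd a) = e - seifertDelta b a n c},
        starTerm (W 3 1) p := by
  set Γ := seifertPlumbing b n c with hΓ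
  set P := {p : ℤ × (Fin 3 → ℤˣ) | Odd p.1 ∧
    (starExp a p : ℚ) ^ 2 / (4 * fiberProd a) = e - seifertDelta b a n c} with hP
  set L := Γ.parityCovecs ∩ {l | Γ.covecExp l = e / Γ.orderH1} with hL
  have hmem : ∀ p, p ∈ P ↔ starCovec n p ∈ L := by
    intro p
    rw [hP, hL, Set.mem_inter_iff, hΓ, starCovec_mem_parityCovecs]
    refine and_congr ?_ (covecExp_starCovec_eq_iff hneg ha hca p e).symm
    rw [Int.odd_iff]
    rfl
  have hPfin : P.Finite := by
    refine Set.Finite.of_finite_image ((hneg.finite_covecExp (e / Γ.orderH1)).subset ?_)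
      (starCovec_injective n).injOn
    rintro _ ⟨p, hp, rfl⟩
    exact (hmem p).mp hp
  have h1 : Γ.totalSeries hneg W (e / Γ.orderH1) = ∑ᶠ p ∈ P,
      C (∏ v, W (Γ.deg v) (starCovec n p v)) * T ((∑ v, starCovec n p v) / 2) := by
    rw [PlumbingGraph.totalSeries_apply, ← finsum_mem_image (starCovec_injective n).injOn
      (f := fun l => C (∏ v, W (Γ.deg v) (l v)) * T ((∑ v, l v) / 2))]
    -- The two index sets differ, but only by covectors whose coefficient vanishes.
    refine finsum_mem_inter_support_eq _ _ _ ?_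
    ext l
    refine ⟨fun ⟨hl, hs⟩ => ⟨?_, hs⟩, fun ⟨hl, hs⟩ => ⟨?_, hs⟩⟩
    · have h0 : ∏ v, W (Γ.deg v) (l v) ≠ 0 := by
        intro h0
        refine hs ?_
        simp only [h0, map_zero, zero_mul]
      obtain ⟨p, rfl⟩ := exists_starCovec_of_prod_ne_zero hW h0
      exact ⟨p, (hmem p).mpr hl, rfl⟩
    · obtain ⟨p, hp, rfl⟩ := hl
      exact (hmem p).mp hp
  rw [TQSeries.subst, h1]
  refine ((tSquare : R[T;T⁻¹] →+* R[T;T⁻¹]).toAddMonoidHom.map_finsum_mem _ hPfin).trans ?_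
  refine finsum_mem_congr rfl fun p hp => ?_
  have hodd : Odd p.1 := hp.1
  -- The sum of `r` and three signs, four odd numbers, is even; hence `t ↦ t ^ 2` undoes the halving
  -- of the exponent.
  have heven : Even (∑ v, starCovec n p v) := by
    rw [sum_starCovec, Fin.sum_univ_three]
    have hu : ∀ i, Odd (p.2 i : ℤ) := fun i => by
      rcases Int.units_eq_one_or (p.2 i) with h | h <;> rw [h] <;> decide
    exact hodd.add_odd (((hu 0).add_odd (hu 1)).add_odd (hu 2))
  change tSquare _ = _
  rw [tSquare_C_mul_T, Int.two_mul_ediv_two_of_even heven, prod_starCovec hW, sum_starCovec,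
    hW.three_odd hodd, starTerm]

/-- The variable `T`, as a unit of the ring of Laurent polynomials. -/
noncomputable def unitT (R : Type*) [CommRing R] : R[T;T⁻¹]ˣ where
  val := T 1
  inv := T (-1)
  val_inv := by rw [← T_add, add_neg_cancel, T_zero]
  inv_val := by rw [← T_add, neg_add_cancel, T_zero]

theorem unitT_zpow (m : ℤ) : ((unitT R ^ m : R[T;T⁻¹]ˣ) : R[T;T⁻¹]) = T m := by
  induction m with
  | zero => simp
  | succ i ih => rw [zpow_add_one, Units.val_mul, ih, unitT, ← T_add]
  | pred i ih => rw [zpow_sub_one, Units.val_mul, ih, unitT, Units.inv_mk, ← T_add, sub_eq_add_neg]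

theorem seifertFactor_eq_binomial (p : ℤ) : seifertFactor R p
    = C (((unitT R)⁻¹ : R[T;T⁻¹]ˣ) : R[T;T⁻¹]) * T p
      - C ((unitT R : R[T;T⁻¹]ˣ) : R[T;T⁻¹]) * T (-p) := rfl

/-- The signs are arranged so that the term of `ε` has coefficient `-ε = W 1 ε` and `t`-exponent
`ε`, as at a leaf. -/
theorem seifertFactor_eq_sum (p : ℤ) : seifertFactor R p
    = ∑ ε : ℤˣ, C (C (-((ε : ℤ) : R)) * T (ε : ℤ)) * T (-(ε * p)) := by
  rw [show (Finset.univ : Finset ℤˣ) = {1, -1} from rfl, Finset.sum_pair (by decide)]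
  simp [seifertFactor]
  ring

theorem f0Num_eq_sum {k : ℕ} (a : Fin k → ℤ) : f0Num R a
    = ∑ ε : Fin k → ℤˣ, C (C (∏ i, -((ε i : ℤ) : R)) * T (∑ i, (ε i : ℤ)))
        * T (-∑ i, (ε i : ℤ) * fiberProdOther a i) := by
  have hT : ∀ {S : Type _} [CommRing S] (f : Fin k → ℤ),
      ∏ i, (T (f i) : S[T;T⁻¹]) = T (∑ i, f i) := by
    intro S _ f
    induction (Finset.univ : Finset (Fin k)) using Finset.induction_on with
    | empty => simp
    | insert i s hi ih => rw [Finset.prod_insert hi, Finset.sum_insert hi, ih, T_add]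
  simp only [f0Num, seifertFactor_eq_sum, Finset.prod_univ_sum, Fintype.piFinset_univ]
  refine Finset.sum_congr rfl fun ε _ => ?_
  rw [Finset.prod_mul_distrib, ← map_prod, Finset.prod_mul_distrib, ← map_prod, hT, hT,
    Finset.sum_neg_distrib]

theorem asymExpansion_f0 (y : R) {a : Fin 3 → ℤ} (m : ℤ) :
    asymExpansion y (f0Num R a) (f0Den R a) m
      = ∑ ε : Fin 3 → ℤˣ, (C (∏ i, -((ε i : ℤ) : R)) * T (∑ i, (ε i : ℤ)))
        * asymExpansion y 1 (seifertFactor R (fiberProd a))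
          (m + ∑ i, (ε i : ℤ) * fiberProdOther a i) := by
  rw [f0Num_eq_sum, asymExpansion_sum, f0Den, pow_one]
  simp only [sub_neg_eq_add]

theorem starTerm_eq (y : R) {a : Fin 3 → ℤ} (ha : ∀ i, 0 < a i) {p : ℤ × (Fin 3 → ℤˣ)}
    (hp : Odd p.1) :
    starTerm y p = (C (∏ i, -((p.2 i : ℤ) : R)) * T (∑ i, (p.2 i : ℤ)))
        * asymExpansion y 1 (seifertFactor R (fiberProd a))
          (-starExp a p + ∑ i, (p.2 i : ℤ) * fiberProdOther a i) := by
  rw [starExp, neg_add, neg_add_cancel_right, seifertFactor_eq_binomial,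
    asymExpansion_one_binomial y (fiberProd_pos ha) _ hp, unitT_zpow, starTerm, T_add, map_mul,
    smul_eq_C_mul]
  ring

theorem laplace_asymExpansion_f0 (y : R) {a : Fin 3 → ℤ} (ha : ∀ i, 0 < a i) (x : ℚ) :
    laplace (fiberProd a) (asymExpansion y (f0Num R a) (f0Den R a)) x
      = ∑ᶠ p ∈ {p : ℤ × (Fin 3 → ℤˣ) | Odd p.1 ∧
          (starExp a p : ℚ) ^ 2 / (4 * fiberProd a) = x}, starTerm y p := by
  set E := {m : ℤ | (m : ℚ) ^ 2 / (4 * fiberProd a) = x} with hE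
  have hEfin : E.Finite := finite_sq_div_eq _ (fiberProd_pos ha) x
  let G : ℤ × (Fin 3 → ℤˣ) → R[T;T⁻¹] := fun p =>
    (C (∏ i, -((p.2 i : ℤ) : R)) * T (∑ i, (p.2 i : ℤ)))
      * asymExpansion y 1 (seifertFactor R (fiberProd a))
        (p.1 + ∑ i, (p.2 i : ℤ) * fiberProdOther a i)
  -- The covector `(r, ε)` corresponds to `z ^ (-starExp)`; the sign is invisible to the Laplace
  -- transform, which only sees the square.
  let ψ : ℤ × (Fin 3 → ℤˣ) → ℤ × (Fin 3 → ℤˣ) := fun p => (-starExp a p, p.2)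
  have hψ : Function.Injective ψ := by
    rintro ⟨r, ε⟩ ⟨r', ε'⟩ h
    obtain ⟨h1, rfl⟩ := Prod.mk.inj h
    rw [neg_inj, starExp, starExp, add_left_inj] at h1
    exact Prod.ext (mul_left_cancel₀ (fiberProd_pos ha).ne' h1) rfl
  set P := {p : ℤ × (Fin 3 → ℤˣ) | Odd p.1 ∧ (starExp a p : ℚ) ^ 2 / (4 * fiberProd a) = x} with hP
  have h1 : ∑ᶠ p ∈ P, starTerm y p = ∑ᶠ p ∈ ψ '' P, G p := by
    rw [finsum_mem_image hψ.injOn]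
    exact finsum_mem_congr rfl fun p hp => starTerm_eq y ha hp.1
  have h2 : ∑ᶠ p ∈ ψ '' P, G p = ∑ᶠ p ∈ E ×ˢ (Set.univ : Set (Fin 3 → ℤˣ)), G p := by
    refine finsum_mem_inter_support_eq _ _ _ ?_
    ext q
    refine ⟨fun ⟨hq, hs⟩ => ⟨?_, hs⟩, fun ⟨hq, hs⟩ => ⟨?_, hs⟩⟩
    · obtain ⟨p, hp, rfl⟩ := hq
      refine ⟨?_, Set.mem_univ _⟩
      have := hp.2
      simpa [ψ, hE] using this
    -- Outside the image of `ψ` the shifted exponent is not an odd multiple of `A`, so the inverse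
    -- binomial has no such term.
    · by_contra hne
      refine hs ?_
      simp only [G, seifertFactor_eq_binomial]
      rw [asymExpansion_one_binomial_eq_zero y (fiberProd_pos ha), mul_zero]
      intro r hr hqr
      have hq1 : q.1 = -starExp a (r, q.2) := by
        rw [starExp]
        linarith
      refine hne ⟨(r, q.2), ⟨hr, ?_⟩, Prod.ext hq1.symm rfl⟩
      have := hq.1
      rw [hE, Set.mem_ofPred_eq, hq1] at this
      simpa using this
  have hfin : (E ×ˢ (Set.univ : Set (Fin 3 → ℤˣ))).Finite := hEfin.prod Set.finite_univ
  rw [h1, h2, finsum_mem_def, finsum_curry]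
  · rw [laplace]
    refine finsum_congr fun m => ?_
    rw [finsum_eq_sum_of_fintype]
    by_cases hm : m ∈ E
    · have hm' : (m : ℚ) ^ 2 / (4 * fiberProd a) = x := hm
      simp only [hm', finsum_true, asymExpansion_f0]
      refine Finset.sum_congr rfl fun ε _ => ?_
      have hmε : (m, ε) ∈ E ×ˢ (Set.univ : Set (Fin 3 → ℤˣ)) := ⟨hm, Set.mem_univ ε⟩
      rw [Set.indicator_of_mem hmε]
    · have hm' : ¬(m : ℚ) ^ 2 / (4 * fiberProd a) = x := hm
      rw [Finset.sum_eq_zero fun ε _ => Set.indicator_of_notMem (fun h => hm h.1) G]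
      simp [hm']
  · exact hfin.subset Set.support_indicator_subset

theorem totalSeries_subst_eq {W : ℕ → ℤ → R} (hW : IsAdmissible W) {b : ℤ} {a : Fin 3 → ℤ}
    {n : Fin 3 → ℕ} {c : (i : Fin 3) → Fin (n i + 1) → ℤ} (ha : ∀ i, 0 < a i)
    (hca : ∀ i, (continuants (n i) (c i)).1 = a i) (hneg : (seifertPlumbing b n c).NegDef) :
    ((seifertPlumbing b n c).totalSeries hneg W).subst (seifertPlumbing b n c).orderH1
      = (laplace (fiberProd a) (asymExpansion (W 3 1) (f0Num R a) (f0Den R a))).qShift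
          (seifertDelta b a n c) := by
  funext e
  rw [totalSeries_subst_apply hW ha hca hneg, TQSeries.qShift, laplace_asymExpansion_f0 _ ha]

/-- `W 1` and `W 2` are forced by admissibility, and the parity condition at the node means that `W
3` is only evaluated at odd integers, where `W 3 1` determines it. -/
theorem totalSeries_congr_of_three_one_eq {W W' : ℕ → ℤ → R} (hW : IsAdmissible W)
    (hW' : IsAdmissible W') (h : W 3 1 = W' 3 1) {b : ℤ} {n : Fin 3 → ℕ}
    {c : (i : Fin 3) → Fin (n i + 1) → ℤ} (hneg : (seifertPlumbing b n c).NegDef) :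
    (seifertPlumbing b n c).totalSeries hneg W = (seifertPlumbing b n c).totalSeries hneg W' := by
  funext e
  rw [PlumbingGraph.totalSeries_apply, PlumbingGraph.totalSeries_apply]
  refine finsum_mem_congr rfl fun l hl => ?_
  congr 2
  refine Finset.prod_congr rfl fun v _ => ?_
  have hv := hl.1 v
  rcases v with _ | ⟨i, j⟩
  · rw [seifertPlumbing_deg_none] at hv ⊢
    have hodd : Odd (l none) := Int.odd_iff.mpr hv
    rw [hW.three_odd hodd, hW'.three_odd hodd, h]
  · rw [seifertPlumbing_deg_some]
    split_ifs
    · rw [hW.one, hW'.one]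
    · rw [hW.two, hW'.two]

end Main

theorem theorem5p2 {R : Type*} [CommRing R] (W : ℕ → ℤ → R) (hW : IsAdmissible W)
    (b : ℤ) (a β : Fin 3 → ℤ) (n : Fin 3 → ℕ) (c : (i : Fin 3) → Fin (n i + 1) → ℤ)
    (ha : ∀ i, 0 < a i) (hcop : ∀ i, IsCoprime (a i) (β i))
    (hc : ∀ i, contFrac (n i) (c i) = (a i : ℚ) / (β i : ℚ))
    (hneg : (seifertPlumbing b n c).NegDef) :
    ((seifertPlumbing b n c).totalSeries hneg W).subst (seifertPlumbing b n c).orderH1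
        = (laplace (fiberProd a) (asymExpansion (W 3 1) (f0Num R a) (f0Den R a))).qShift
            (seifertDelta b a n c) ∧
      ∀ [Invertible (2 : R)], W 3 1 = ⅟(2 : R) →
        (seifertPlumbing b n c).totalSeries hneg W
            = (seifertPlumbing b n c).totalSeries hneg (WHat R) ∧
          ((seifertPlumbing b n c).totalSeries hneg (WHat R)).subst
              (seifertPlumbing b n c).orderH1
            = (laplace (fiberProd a) (symExpansion R (f0Num R a) (f0Den R a))).qShift
                (seifertDelta b a n c) := by
  -- Both fractions are reduced and have positive numerators, so `a i` is the determinant of the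
  -- `i`-th leg.
  have hca : ∀ i, (continuants (n i) (c i)).1 = a i := by
    intro i
    have hpos := posDef_chainMatrix_of_negDef hneg i
    refine eq_of_isCoprime_div_eq (ha i) (continuants_pos hpos) (continuants_pos_snd hpos) (hcop i)
      (isCoprime_continuants _ _) ?_
    rw [← contFrac_eq_continuants _ _ hpos, hc]
  refine ⟨totalSeries_subst_eq hW ha hca hneg, fun {_} h => ?_⟩
  refine ⟨totalSeries_congr_of_three_one_eq hW (isAdmissible_wHat R)
    (h.trans (wHat_three_one R).symm) hneg, ?_⟩
  rw [totalSeries_subst_eq (isAdmissible_wHat R) ha hca hneg, wHat_three_one,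
    funext (symExpansion_eq_asymExpansion (R := R) (f0Num R a) (f0Den R a))]
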